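/- Let $d\ge 1$, let $\Omega\subset\mathbb{R}^d$ be a bounded Lipschitz domain, let $k\in\mathbb{C}$, and let $G_k$ be the outgoing full-space fundamental solution of the Helmholtz equation, i.e. $(\Delta+k^2)G_k=-\delta$ in the sense of distributions on $\mathbb{R}^d$, and $G_k$ satisfies the Sommerfeld radiation condition $|x|^{(d-1)/2}\big(\partial_{|x|}G_k(x)-ik\,G_k(x)\big)\to 0$ as $|x|\to\infty$, uniformly in the direction of $x$. For complex-valued $\alpha,\beta\in L^\infty(\Omega)$ and $u\in H^1(\Omega)$, consider on $\Omega$ the volume integral operator $$Au(x)=\operatorname{div}\int_\Omega G_k(x-y)\,\alpha(y)\,\nabla u(y)\,dy+\int_\Omega G_k(x-y)\,\beta(y)\,u(y)\,dy ,$$ where the divergence is taken in the sense of distributions on $\Omega$. 1. If $\alpha,\beta\in L^\infty(\Omega)$, then $A:H^1(\Omega)\to H^1(\Omega)$ is bounded. 2. If in addition $\nabla\alpha\in L^\infty$, where $\alpha$ is extended by zero outside $\Omega$ and $\nabla\alpha$ is its distributional gradient on $\mathbb{R}^d$, then $A$ is bounded in $L^2(\Omega)$, i.e. it extends from $H^1(\Omega)$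 to a bounded operator $L^2(\Omega)\to L^2(\Omega)$. 3. If $\alpha,\beta\in L^\infty(\Omega)$ and only the distributional gradient of $\alpha$ inside the open set $\Omega$ is in $L^\infty(\Omega)$, then the restriction of $A$ to $H^1_0(\Omega)$ (the closure of $C_c^\infty(\Omega)$ in $H^1(\Omega)$) extends to a bounded operator $L^2(\Omega)\to L^2(\Omega)$. -/

import Mathlib

open MeasureTheory Filter Topology Set
open scoped ContDiff ENNReal NNReal

noncomputable section

namespace AcousticVIE

/-- Euclidean space `ℝ^d`. -/
abbrev E (d : ℕ) : Type := EuclideanSpace ℝ (Fin d)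

/-- The classical partial derivative `∂_j φ`. -/
def partialDeriv {d : ℕ} (j : Fin d) (φ : E d → ℂ) (x : E d) : ℂ :=
  fderiv ℝ φ x (EuclideanSpace.single j (1 : ℝ))

/-- Test functions on `Ω`: the elements of `C_c^∞(Ω)`. -/
structure IsTest {d : ℕ} (Ω : Set (E d)) (φ : E d → ℂ) : Prop where
  contDiff : ContDiff ℝ ∞ φ
  hasCompactSupport : HasCompactSupport φ
  tsupport_subset : tsupport φ ⊆ Ω

/-- Bounded Lipschitz domains: bounded, open and connected, and near each boundary point the
set of points strictly above the graph of a Lipschitz function, with respect to some unit vector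
`e` as the upward direction.  (`x - ⟪e, x⟫ e` is the component of `x` orthogonal to `e`.) -/
structure IsBoundedLipschitzDomain {d : ℕ} (Ω : Set (E d)) : Prop where
  isOpen : IsOpen Ω
  isConnected : IsConnected Ω
  isBounded : Bornology.IsBounded Ω
  lipschitz_boundary : ∀ p ∈ frontier Ω, ∃ (e : E d) (L : ℝ≥0) (γ : E d → ℝ) (r : ℝ),
    ‖e‖ = 1 ∧ LipschitzWith L γ ∧ 0 < r ∧
      ∀ x ∈ Metric.ball p r, x ∈ Ω ↔ γ (x - (inner ℝ e x) • e) < inner ℝ e x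

/-- `g = (g_1, …, g_d)` is the weak (distributional) gradient of `f` on the open set `Ω`. -/
def HasWeakGradient {d : ℕ} (Ω : Set (E d)) (f : E d → ℂ) (g : Fin d → E d → ℂ) : Prop :=
  ∀ φ : E d → ℂ, IsTest Ω φ → ∀ j : Fin d,
    ∫ x in Ω, f x * partialDeriv j φ x = -∫ x in Ω, g j x * φ x

/-- The complex Hilbert space `L²(Ω)`. -/
abbrev L2 {d : ℕ} (Ω : Set (E d)) : Type :=
  Lp ℂ 2 ((volume : Measure (E d)).restrict Ω)

theorem partialDeriv_continuous {d : ℕ} {Ω : Set (E d)} {φ : E d → ℂ} (hφ : IsTest Ω φ)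
    (j : Fin d) : Continuous (partialDeriv j φ) :=
  (hφ.contDiff.continuous_fderiv (by simp)).clm_apply continuous_const

theorem partialDeriv_hasCompactSupport {d : ℕ} {Ω : Set (E d)} {φ : E d → ℂ}
    (hφ : IsTest Ω φ) (j : Fin d) : HasCompactSupport (partialDeriv j φ) :=
  hφ.hasCompactSupport.fderiv_apply (𝕜 := ℝ) _

theorem L2_mul_integrable {d : ℕ} {Ω : Set (E d)} (u : L2 Ω) {ψ : E d → ℂ}
    (hc : Continuous ψ) (hs : HasCompactSupport ψ) :
    Integrable (fun x => u x * ψ x) ((volume : Measure (E d)).restrict Ω) :=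
  (Lp.memLp u).integrable_mul (q := 2) (hc.memLp_of_hasCompactSupport hs)

/-- The Sobolev space `H¹(Ω)`: pairs `(u, ∇u)` with `u ∈ L²(Ω)` whose weak gradient is in
`L²(Ω)^d`, with the norm `(‖u‖² + ∑_j ‖∂_j u‖²)^{1/2}`. -/
def H1 {d : ℕ} (Ω : Set (E d)) :
    Submodule ℂ (WithLp 2 (L2 Ω × PiLp 2 (fun _ : Fin d => L2 Ω))) where
  carrier := {w | HasWeakGradient Ω (w.fst : E d → ℂ) (fun j => (w.snd j : E d → ℂ))}
  zero_mem' := by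
    intro φ hφ j
    have h : ((0 : L2 Ω) : E d → ℂ) =ᵐ[(volume : Measure (E d)).restrict Ω] 0 :=
      Lp.coeFn_zero _ _ _
    have key : ∀ ψ : E d → ℂ, ∫ x in Ω, ((0 : L2 Ω) : E d → ℂ) x * ψ x = 0 := fun ψ =>
      integral_eq_zero_of_ae (by
        filter_upwards [h] with x hx
        rw [hx, Pi.zero_apply, zero_mul])
    exact (key _).trans ((congrArg Neg.neg (key φ)).trans neg_zero).symm
  add_mem' := by
    intro v w hv hw φ hφ j
    have key : ∀ (a b : L2 Ω) {ψ : E d → ℂ}, Continuous ψ → HasCompactSupport ψ →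
        ∫ x in Ω, ((a + b : L2 Ω) : E d → ℂ) x * ψ x
          = (∫ x in Ω, a x * ψ x) + ∫ x in Ω, b x * ψ x := by
      intro a b ψ hc hs
      rw [← integral_add (L2_mul_integrable a hc hs) (L2_mul_integrable b hc hs)]
      refine integral_congr_ae ?_
      filter_upwards [Lp.coeFn_add a b] with x hx
      rw [hx, Pi.add_apply, add_mul]
    have e1 := key v.fst w.fst (partialDeriv_continuous hφ j)
      (partialDeriv_hasCompactSupport hφ j)
    have e2 := key (v.snd j) (w.snd j) hφ.contDiff.continuous hφ.hasCompactSupport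
    have e3 := hv φ hφ j
    have e4 := hw φ hφ j
    simp only [WithLp.add_fst, WithLp.add_snd, PiLp.add_apply]
    rw [e1, e2, e3, e4]
    ring
  smul_mem' := by
    intro c w hw φ hφ j
    have key : ∀ (a : L2 Ω) (ψ : E d → ℂ),
        ∫ x in Ω, ((c • a : L2 Ω) : E d → ℂ) x * ψ x = c * ∫ x in Ω, a x * ψ x := by
      intro a ψ
      rw [← integral_const_mul]
      refine integral_congr_ae ?_
      filter_upwards [Lp.coeFn_smul c a] with x hx
      rw [hx, Pi.smul_apply, smul_eq_mul, mul_assoc]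
    have e3 := hw φ hφ j
    simp only [WithLp.smul_fst, WithLp.smul_snd, PiLp.smul_apply]
    rw [key, key, e3]
    ring

/-- The function `u ∈ L²(Ω)` underlying an element of `H¹(Ω)`. -/
def toL2 {d : ℕ} {Ω : Set (E d)} (u : H1 Ω) : L2 Ω :=
  (u : WithLp 2 (L2 Ω × PiLp 2 (fun _ : Fin d => L2 Ω))).fst

/-- The weak partial derivative `∂_j u ∈ L²(Ω)` of an element of `H¹(Ω)`. -/
def grad {d : ℕ} {Ω : Set (E d)} (u : H1 Ω) (j : Fin d) : L2 Ω :=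
  (u : WithLp 2 (L2 Ω × PiLp 2 (fun _ : Fin d => L2 Ω))).snd j

/-- `H¹₀(Ω)`: the closure of `C_c^∞(Ω)` in `H¹(Ω)`. -/
def H10 {d : ℕ} (Ω : Set (E d)) : Set (H1 Ω) :=
  closure {u | ∃ φ : E d → ℂ, IsTest Ω φ ∧
    (toL2 u : E d → ℂ) =ᵐ[(volume : Measure (E d)).restrict Ω] φ}

/-- `G` is the outgoing full-space fundamental solution of the Helmholtz equation with wave
number `k`, that is, `(Δ + k²) G = -δ` in the sense of distributions on `ℝ^d` and `G` satisfies
the Sommerfeld radiation condition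
`|x|^{(d-1)/2} (∂G/∂|x| - i k G)(x) → 0` as `|x| → ∞`, uniformly in the direction of `x`.
(The distribution is represented by its locally integrable density, which is taken
differentiable away from the origin, so that the radial derivative makes sense.) -/
structure IsOutgoingFundamentalSolution {d : ℕ} (k : ℂ) (G : E d → ℂ) : Prop where
  locallyIntegrable : LocallyIntegrable G (volume : Measure (E d))
  differentiableAt : ∀ x : E d, x ≠ 0 → DifferentiableAt ℝ G x
  fundamental : ∀ φ : E d → ℂ, IsTest univ φ →
    ∫ x, G x * (Laplacian.laplacian φ x + k ^ 2 * φ x) = -φ 0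
  sommerfeld : Tendsto
    (fun x : E d => ‖x‖ ^ (((d : ℝ) - 1) / 2) *
      ‖fderiv ℝ G x (‖x‖⁻¹ • x) - Complex.I * k * G x‖)
    (Bornology.cobounded (E d)) (𝓝 0)

/-- The volume potential `x ↦ ∫_Ω G(x - y) f(y) dy`. -/
def volumePotential {d : ℕ} (Ω : Set (E d)) (G : E d → ℂ) (f : E d → ℂ) (x : E d) : ℂ :=
  ∫ y in Ω, G (x - y) * f y

/-- For `u ∈ H¹(Ω)`, the distribution on `Ω`
`A u = div ∫_Ω G(· - y) α(y) ∇u(y) dy + ∫_Ω G(· - y) β(y) u(y) dy`,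
evaluated at a test function `φ`; the divergence is taken in the sense of distributions. -/
def volumeOperator {d : ℕ} (Ω : Set (E d)) (G α β : E d → ℂ) (u : H1 Ω) (φ : E d → ℂ) : ℂ :=
  -(∑ j : Fin d,
      ∫ x in Ω, volumePotential Ω G (fun y => α y * grad u j y) x * partialDeriv j φ x)
    + ∫ x in Ω, volumePotential Ω G (fun y => β y * toL2 u y) x * φ x

/-- The distribution `A u` on `Ω` is the function `v ∈ L²(Ω)`. -/
def VolumeOperatorEq {d : ℕ} (Ω : Set (E d)) (G α β : E d → ℂ) (u : H1 Ω) (v : L2 Ω) : Prop :=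
  ∀ φ : E d → ℂ, IsTest Ω φ → ∫ x in Ω, v x * φ x = volumeOperator Ω G α β u φ

end AcousticVIE

end

open AcousticVIE

/-! Let `K` be a smooth compactly supported truncation of `G` agreeing with it on Ω − Ω, so that on
Ω the volume potential is convolution with an integrable kernel. Testing the Helmholtz equation with
a cutoff times a plane wave shows that (1 + |ξ|²)|𝓕K(ξ)| is bounded (`exists_quadratic_decay`,
`exists_truncation`). By Plancherel, convolution with `K` followed by at most two derivatives is
therefore bounded in L². Everything is done weakly: Fubini moves the convolution to the test
function, and `exists_potential_operators` supplies the transposes `S₀`, `S₁ j`, `S₂ i j`.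

The H¹ bound follows at once: A u involves one derivative of the potential of α∇u and none of that
of βu, so its gradient needs at most two.

For the L² bounds one writes α ∂_j u = ∂_j(αu) − g_j u, where g = ∇α, and moves ∂_j to the kernel.
The convolved test function need not vanish near ∂Ω, so this identity is needed on all of ℝ^d after
extension by zero (`HasProductRule`). For u in H¹₀ it holds on test functions and survives H¹
limits. For general u, the zero extension of α has a bounded gradient, whence |α| ≤ L dist(·, Ωᶜ)
almost everywhere. This compensates the gradients of cutoffs at the boundary, and a limit of cutoffs
gives the rule with no boundary term. -/

noncomputable section

namespace AcousticVIE

open scoped FourierTransform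

variable {d : ℕ}

/-! ### Calculus of test functions. -/

section TestFunctions

theorem IsTest.differentiable {Ω : Set (E d)} {φ : E d → ℂ} (hφ : IsTest Ω φ) :
    Differentiable ℝ φ :=
  hφ.contDiff.differentiable (by simp)

theorem IsTest.continuous {Ω : Set (E d)} {φ : E d → ℂ} (hφ : IsTest Ω φ) : Continuous φ :=
  hφ.contDiff.continuous

theorem IsTest.eq_zero_of_notMem {Ω : Set (E d)} {φ : E d → ℂ} (hφ : IsTest Ω φ) {x : E d}
    (hx : x ∉ Ω) : φ x = 0 :=
  image_eq_zero_of_notMem_tsupport fun h => hx (hφ.tsupport_subset h)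

theorem IsTest.integrable {Ω : Set (E d)} {φ : E d → ℂ} (hφ : IsTest Ω φ) :
    Integrable φ (volume : Measure (E d)) :=
  hφ.continuous.integrable_of_hasCompactSupport hφ.hasCompactSupport

theorem contDiff_partialDeriv {φ : E d → ℂ} (hφ : ContDiff ℝ ∞ φ) (j : Fin d) :
    ContDiff ℝ ∞ (partialDeriv j φ) :=
  (hφ.fderiv_right (by simp)).clm_apply contDiff_const

theorem IsTest.partialDeriv {Ω : Set (E d)} {φ : E d → ℂ} (hφ : IsTest Ω φ) (j : Fin d) :
    IsTest Ω (partialDeriv j φ) where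
  contDiff := contDiff_partialDeriv hφ.contDiff j
  hasCompactSupport := partialDeriv_hasCompactSupport hφ j
  tsupport_subset := (tsupport_fderiv_apply_subset ℝ _).trans hφ.tsupport_subset

theorem IsTest.mul_left {Ω : Set (E d)} {φ ψ : E d → ℂ} (hφ : IsTest Ω φ)
    (hψ : ContDiff ℝ ∞ ψ) : IsTest Ω (fun x => ψ x * φ x) where
  contDiff := hψ.mul hφ.contDiff
  hasCompactSupport := hφ.hasCompactSupport.mul_left
  tsupport_subset := (tsupport_mul_subset_right (f := ψ) (g := φ)).trans hφ.tsupport_subset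

theorem IsTest.mul_right {Ω : Set (E d)} {φ ψ : E d → ℂ} (hφ : IsTest Ω φ)
    (hψ : ContDiff ℝ ∞ ψ) : IsTest Ω (fun x => φ x * ψ x) := by
  simpa only [mul_comm] using hφ.mul_left hψ

theorem IsTest.exists_bound {Ω : Set (E d)} {φ : E d → ℂ} (hφ : IsTest Ω φ) :
    ∃ C, ∀ x, ‖φ x‖ ≤ C :=
  hφ.continuous.bounded_above_of_compact_support hφ.hasCompactSupport

theorem partialDeriv_mul {φ ψ : E d → ℂ} (hφ : Differentiable ℝ φ) (hψ : Differentiable ℝ ψ)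
    (j : Fin d) (x : E d) :
    partialDeriv j (fun x => φ x * ψ x) x
      = φ x * partialDeriv j ψ x + partialDeriv j φ x * ψ x := by
  have h := fderiv_fun_mul (hφ x) (hψ x)
  simp only [partialDeriv, h, _root_.add_apply, _root_.smul_apply,
    smul_eq_mul]
  ring

theorem laplacian_eq_sum_partialDeriv {φ : E d → ℂ} (hφ : ContDiff ℝ ∞ φ) (x : E d) :
    Laplacian.laplacian φ x = ∑ j, partialDeriv j (partialDeriv j φ) x := by
  rw [InnerProductSpace.laplacian_eq_iteratedFDeriv_orthonormalBasis φ
    (EuclideanSpace.basisFun (Fin d) ℝ)]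
  refine Finset.sum_congr rfl fun j _ => ?_
  have h1 : DifferentiableAt ℝ (fderiv ℝ φ) x :=
    ((hφ.fderiv_right (m := ∞) (by simp)).differentiable (by simp)) x
  rw [iteratedFDeriv_two_apply]
  simp only [EuclideanSpace.basisFun_apply, Matrix.cons_val_zero, Matrix.cons_val_one]
  have h2 : partialDeriv j φ = fun y => fderiv ℝ φ y (EuclideanSpace.single j (1 : ℝ)) := rfl
  rw [h2]
  unfold partialDeriv
  rw [fderiv_clm_apply h1 (differentiableAt_const _)]
  simp

end TestFunctions

/-! ### Derivatives of functions modulated by a plane wave. -/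

section PlaneWave

/-- The plane wave `x ↦ exp(-2πi ⟪x, ξ⟫)`. -/
def planeWave (ξ x : E d) : ℂ :=
  Complex.exp (((-2 * Real.pi * inner ℝ x ξ : ℝ) : ℂ) * Complex.I)

theorem contDiff_planeWave (ξ : E d) : ContDiff ℝ ∞ (planeWave ξ) := by
  unfold planeWave
  refine ContDiff.cexp (ContDiff.mul ?_ contDiff_const)
  refine Complex.ofRealCLM.contDiff.comp ?_
  exact contDiff_const.mul (contDiff_id.inner ℝ contDiff_const)

theorem partialDeriv_planeWave (ξ : E d) (j : Fin d) (x : E d) :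
    partialDeriv j (planeWave ξ) x
      = (-2 * Real.pi * Complex.I * (ξ j : ℂ)) * planeWave ξ x := by
  have h1 : HasFDerivAt (fun y : E d => (-2 * Real.pi * inner ℝ y ξ : ℝ))
      ((-2 * Real.pi) • (innerSL ℝ ξ)) x := by
    have := ((innerSL ℝ ξ).hasFDerivAt (x := x)).const_mul (-2 * Real.pi)
    refine this.congr_of_eventuallyEq (Eventually.of_forall fun y => ?_)
    simp only [innerSL_apply_apply]
    rw [real_inner_comm]
  have h2 := (Complex.ofRealCLM.hasFDerivAt.comp x h1).mul_const Complex.I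
  have h3 := h2.cexp
  have h4 : fderiv ℝ (planeWave ξ) x = _ := h3.fderiv
  unfold partialDeriv
  rw [h4]
  simp [planeWave, innerSL_apply_apply, EuclideanSpace.inner_single_right]
  ring

theorem partialDeriv_mul_planeWave {φ : E d → ℂ} (hφ : Differentiable ℝ φ) (ξ : E d) (j : Fin d) :
    partialDeriv j (fun x => φ x * planeWave ξ x) = fun x =>
      (partialDeriv j φ x + (-2 * Real.pi * Complex.I * (ξ j : ℂ)) * φ x) * planeWave ξ x := by
  funext x
  rw [partialDeriv_mul hφ ((contDiff_planeWave ξ).differentiable (by simp)),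
    partialDeriv_planeWave]
  ring

theorem partialDeriv_add {φ ψ : E d → ℂ} (hφ : Differentiable ℝ φ) (hψ : Differentiable ℝ ψ)
    (j : Fin d) (x : E d) :
    partialDeriv j (fun x => φ x + ψ x) x = partialDeriv j φ x + partialDeriv j ψ x := by
  simp only [partialDeriv, fderiv_fun_add (hφ x) (hψ x), _root_.add_apply]

theorem partialDeriv_const_mul {φ : E d → ℂ} (hφ : Differentiable ℝ φ) (c : ℂ)
    (j : Fin d) (x : E d) :
    partialDeriv j (fun x => c * φ x) x = c * partialDeriv j φ x := by
  simp only [partialDeriv, fderiv_const_mul (hφ x) c, _root_.smul_apply, smul_eq_mul]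

theorem laplacian_mul_planeWave {φ : E d → ℂ} (hφ : ContDiff ℝ ∞ φ) (ξ x : E d) :
    Laplacian.laplacian (fun x => φ x * planeWave ξ x) x
      = (∑ j, (partialDeriv j (partialDeriv j φ) x
          + 2 * (-2 * Real.pi * Complex.I * (ξ j : ℂ)) * partialDeriv j φ x)
          - 4 * Real.pi ^ 2 * (‖ξ‖ : ℂ) ^ 2 * φ x) * planeWave ξ x := by
  have hd : Differentiable ℝ φ := hφ.differentiable (by simp)
  have hd' : ∀ j, Differentiable ℝ (partialDeriv j φ) := fun j =>
    (contDiff_partialDeriv hφ j).differentiable (by simp)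
  rw [laplacian_eq_sum_partialDeriv (hφ.mul (contDiff_planeWave ξ))]
  have h1 : ∀ j, partialDeriv j (partialDeriv j (fun x => φ x * planeWave ξ x)) x
      = (partialDeriv j (partialDeriv j φ) x
          + 2 * (-2 * Real.pi * Complex.I * (ξ j : ℂ)) * partialDeriv j φ x
          + (-2 * Real.pi * Complex.I * (ξ j : ℂ)) ^ 2 * φ x) * planeWave ξ x := by
    intro j
    have hs : Differentiable ℝ fun x =>
        partialDeriv j φ x + (-2 * Real.pi * Complex.I * (ξ j : ℂ)) * φ x :=
      (hd' j).add (hd.const_mul _)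
    rw [partialDeriv_mul_planeWave hd, partialDeriv_mul_planeWave hs ξ j]
    simp only
    rw [partialDeriv_add (hd' j) (hd.const_mul _), partialDeriv_const_mul hd]
    ring
  have hnorm : (‖ξ‖ : ℂ) ^ 2 = ∑ j, (ξ j : ℂ) ^ 2 := by
    rw [← Complex.ofReal_pow, EuclideanSpace.norm_sq_eq]
    push_cast
    refine Finset.sum_congr rfl fun j _ => ?_
    rw [← Complex.ofReal_pow, ← Complex.ofReal_pow, Real.norm_eq_abs, sq_abs]
  simp_rw [h1]
  rw [← Finset.sum_mul, Finset.sum_add_distrib, hnorm]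
  congr 1
  rw [sub_eq_add_neg, Finset.mul_sum, Finset.sum_mul, ← Finset.sum_neg_distrib]
  congr 1
  refine Finset.sum_congr rfl fun j _ => ?_
  have := Complex.I_sq
  linear_combination (4 * (Real.pi : ℂ) ^ 2 * (ξ j : ℂ) ^ 2 * φ x) * this

end PlaneWave

/-! ### Fourier decay of the truncated fundamental solution. -/

section FundamentalSolution

variable {k : ℂ} {G : E d → ℂ}

theorem IsTest.integrable_mul {Ω : Set (E d)} {φ : E d → ℂ} (hφ : IsTest Ω φ)
    (hG : LocallyIntegrable G (volume : Measure (E d))) :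
    Integrable (fun x => φ x * G x) (volume : Measure (E d)) := by
  simpa only [smul_eq_mul] using
    hG.integrable_smul_left_of_hasCompactSupport hφ.continuous hφ.hasCompactSupport

theorem fourier_eq_integral_planeWave (f : E d → ℂ) (ξ : E d) :
    𝓕 f ξ = ∫ x, planeWave ξ x * f x := by
  rw [Real.fourier_eq']
  rfl

theorem norm_planeWave (ξ x : E d) : ‖planeWave ξ x‖ = 1 := by
  rw [planeWave, Complex.norm_exp_ofReal_mul_I]

theorem norm_fourier_le (f : E d → ℂ) (ξ : E d) : ‖𝓕 f ξ‖ ≤ ∫ x, ‖f x‖ := by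
  rw [fourier_eq_integral_planeWave]
  refine (norm_integral_le_integral_norm _).trans_eq ?_
  simp_rw [norm_mul, norm_planeWave, one_mul]

theorem integrable_planeWave_mul {f : E d → ℂ} (hf : Integrable f (volume : Measure (E d)))
    (ξ : E d) : Integrable (fun x => planeWave ξ x * f x) (volume : Measure (E d)) :=
  hf.bdd_mul (c := 1) (contDiff_planeWave ξ).continuous.aestronglyMeasurable
    (Eventually.of_forall fun x => (norm_planeWave ξ x).le)

/-- The Helmholtz equation for `φ G` on the Fourier side. -/
theorem IsOutgoingFundamentalSolution.fourier_identity (hG : IsOutgoingFundamentalSolution k G)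
    {φ : E d → ℂ} (hφ : IsTest univ φ) (ξ : E d) :
    4 * Real.pi ^ 2 * (‖ξ‖ : ℂ) ^ 2 * 𝓕 (fun x => φ x * G x) ξ
      = φ 0 + k ^ 2 * 𝓕 (fun x => φ x * G x) ξ
        + ∑ j, (𝓕 (fun x => partialDeriv j (partialDeriv j φ) x * G x) ξ
          + 2 * (-2 * Real.pi * Complex.I * (ξ j : ℂ))
            * 𝓕 (fun x => partialDeriv j φ x * G x) ξ) := by
  have hI : ∀ {ψ : E d → ℂ}, IsTest univ ψ →
      Integrable (fun x => planeWave ξ x * (ψ x * G x)) (volume : Measure (E d)) := fun hψ =>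
    integrable_planeWave_mul (hψ.integrable_mul hG.locallyIntegrable) ξ
  have hJ : ∀ j, Integrable (fun x =>
      planeWave ξ x * (partialDeriv j (partialDeriv j φ) x * G x)
        + 2 * (-2 * Real.pi * Complex.I * (ξ j : ℂ))
          * (planeWave ξ x * (partialDeriv j φ x * G x))) (volume : Measure (E d)) := fun j =>
    (hI ((hφ.partialDeriv j).partialDeriv j)).add ((hI (hφ.partialDeriv j)).const_mul _)
  -- Testing with φ times the plane wave turns the integrals against `G` into Fourier transforms of
  -- `φ G` and of `G` times derivatives of φ.
  have h0 := hG.fundamental _ (hφ.mul_right (contDiff_planeWave ξ))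
  have e0 : planeWave ξ 0 = 1 := by simp [planeWave]
  simp only [e0, mul_one] at h0
  simp_rw [fourier_eq_integral_planeWave]
  have h1 : ∀ x, G x * (Laplacian.laplacian (fun x => φ x * planeWave ξ x) x
        + k ^ 2 * (φ x * planeWave ξ x))
      = (∑ j, (planeWave ξ x * (partialDeriv j (partialDeriv j φ) x * G x)
          + 2 * (-2 * Real.pi * Complex.I * (ξ j : ℂ))
            * (planeWave ξ x * (partialDeriv j φ x * G x))))
        + (k ^ 2 - 4 * Real.pi ^ 2 * (‖ξ‖ : ℂ) ^ 2) * (planeWave ξ x * (φ x * G x)) := by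
    intro x
    rw [laplacian_mul_planeWave hφ.contDiff]
    have : ∑ j, (planeWave ξ x * (partialDeriv j (partialDeriv j φ) x * G x)
          + 2 * (-2 * Real.pi * Complex.I * (ξ j : ℂ))
            * (planeWave ξ x * (partialDeriv j φ x * G x)))
        = (∑ j, (partialDeriv j (partialDeriv j φ) x
          + 2 * (-2 * Real.pi * Complex.I * (ξ j : ℂ)) * partialDeriv j φ x))
          * (planeWave ξ x * G x) := by
      rw [Finset.sum_mul]
      exact Finset.sum_congr rfl fun j _ => by ring
    rw [this]
    ring
  simp_rw [h1] at h0
  rw [integral_add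
    (integrable_finsetSum _ fun j _ => hJ j) ((hI hφ).const_mul _),
    integral_const_mul, integral_finsetSum _ fun j _ => hJ j] at h0
  have h2 : ∀ j, ∫ x, (planeWave ξ x * (partialDeriv j (partialDeriv j φ) x * G x)
          + 2 * (-2 * Real.pi * Complex.I * (ξ j : ℂ))
            * (planeWave ξ x * (partialDeriv j φ x * G x)))
      = (∫ x, planeWave ξ x * (partialDeriv j (partialDeriv j φ) x * G x))
        + 2 * (-2 * Real.pi * Complex.I * (ξ j : ℂ))
          * ∫ x, planeWave ξ x * (partialDeriv j φ x * G x) := fun j => by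
    rw [integral_add (hI ((hφ.partialDeriv j).partialDeriv j))
      ((hI (hφ.partialDeriv j)).const_mul _), integral_const_mul]
  simp_rw [h2] at h0
  linear_combination -h0

/-- This is the bootstrap inequality: the right side has one power of |ξ| fewer, at the price of
replacing φ by ∂_jφ, again a test function. The trivial bound of a Fourier transform by the L¹ norm
then gives linear decay, and linear decay for every ∂_jφ gives quadratic decay. -/
theorem IsOutgoingFundamentalSolution.exists_sq_bound (hG : IsOutgoingFundamentalSolution k G)
    {φ : E d → ℂ} (hφ : IsTest univ φ) :
    ∃ A, 0 ≤ A ∧ ∀ ξ : E d, ‖ξ‖ ^ 2 * ‖𝓕 (fun x => φ x * G x) ξ‖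
      ≤ A + ∑ j, ‖ξ‖ * ‖𝓕 (fun x => partialDeriv j φ x * G x) ξ‖ := by
  set A : ℝ := ‖φ 0‖ + ‖k‖ ^ 2 * (∫ x, ‖φ x * G x‖)
    + ∑ j, ∫ x, ‖partialDeriv j (partialDeriv j φ) x * G x‖ with hA
  have hA0 : 0 ≤ A := by positivity
  refine ⟨A, hA0, fun ξ => ?_⟩
  have hpi := Real.pi_gt_three
  have h1 := congrArg norm (hG.fourier_identity hφ ξ)
  have h2 : ‖4 * (Real.pi : ℂ) ^ 2 * (‖ξ‖ : ℂ) ^ 2 * 𝓕 (fun x => φ x * G x) ξ‖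
      = 4 * Real.pi ^ 2 * (‖ξ‖ ^ 2 * ‖𝓕 (fun x => φ x * G x) ξ‖) := by
    simp only [norm_mul, norm_pow, Complex.norm_real, Complex.norm_ofNat,
      Real.norm_eq_abs, abs_of_pos Real.pi_pos, abs_norm]
    ring
  rw [h2] at h1
  have h3 : ∀ j : Fin d, ‖𝓕 (fun x => partialDeriv j (partialDeriv j φ) x * G x) ξ
          + 2 * (-2 * Real.pi * Complex.I * (ξ j : ℂ))
            * 𝓕 (fun x => partialDeriv j φ x * G x) ξ‖
      ≤ (∫ x, ‖partialDeriv j (partialDeriv j φ) x * G x‖)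
        + 4 * Real.pi * (‖ξ‖ * ‖𝓕 (fun x => partialDeriv j φ x * G x) ξ‖) := by
    intro j
    refine (norm_add_le _ _).trans (add_le_add (norm_fourier_le _ _) ?_)
    have hj : |ξ j| ≤ ‖ξ‖ := by simpa using PiLp.norm_apply_le ξ j
    simp only [norm_mul, norm_neg, Complex.norm_real, Complex.norm_ofNat, Complex.norm_I,
      Real.norm_eq_abs, abs_of_pos Real.pi_pos, mul_one]
    have := mul_le_mul_of_nonneg_right hj
      (norm_nonneg (𝓕 (fun x => partialDeriv j φ x * G x) ξ))
    nlinarith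
  have h4 : 4 * Real.pi ^ 2 * (‖ξ‖ ^ 2 * ‖𝓕 (fun x => φ x * G x) ξ‖)
      ≤ A + 4 * Real.pi * ∑ j, ‖ξ‖ * ‖𝓕 (fun x => partialDeriv j φ x * G x) ξ‖ := by
    rw [h1, hA, add_assoc (_ + _), Finset.mul_sum, ← Finset.sum_add_distrib]
    refine (norm_add_le _ _).trans (add_le_add ((norm_add_le _ _).trans (add_le_add le_rfl ?_))
      ((norm_sum_le _ _).trans (Finset.sum_le_sum fun j _ => h3 j)))
    rw [norm_mul, norm_pow]
    gcongr
    exact norm_fourier_le _ _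
  set S := ∑ j, ‖ξ‖ * ‖𝓕 (fun x => partialDeriv j φ x * G x) ξ‖
  have hS : 0 ≤ S := by positivity
  set X := ‖ξ‖ ^ 2 * ‖𝓕 (fun x => φ x * G x) ξ‖
  have hpos : 0 < 4 * Real.pi ^ 2 := by positivity
  -- All constants are absorbed on division by 4π², since 1 ≤ 4π² and 4π ≤ 4π².
  refine le_of_mul_le_mul_left (h4.trans ?_) hpos
  have hpi1 : 1 ≤ 4 * Real.pi ^ 2 := by nlinarith
  have hpi2 : 4 * Real.pi ≤ 4 * Real.pi ^ 2 := by nlinarith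
  nlinarith [mul_le_mul_of_nonneg_right hpi1 hA0, mul_le_mul_of_nonneg_right hpi2 hS]

/-- The Fourier transform of the truncated fundamental solution decays linearly. -/
theorem IsOutgoingFundamentalSolution.exists_linear_decay (hG : IsOutgoingFundamentalSolution k G)
    {φ : E d → ℂ} (hφ : IsTest univ φ) :
    ∃ C, ∀ ξ : E d, ‖ξ‖ * ‖𝓕 (fun x => φ x * G x) ξ‖ ≤ C := by
  obtain ⟨A, hA0, hA⟩ := hG.exists_sq_bound hφ
  set B := ∑ j, ∫ x, ‖partialDeriv j φ x * G x‖
  have hB : 0 ≤ B := by positivity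
  set D := ∫ x, ‖φ x * G x‖
  have hD : 0 ≤ D := by positivity
  refine ⟨A + B + D, fun ξ => ?_⟩
  have h0 : ‖𝓕 (fun x => φ x * G x) ξ‖ ≤ D := norm_fourier_le _ _
  have h1 : ‖ξ‖ * (‖ξ‖ * ‖𝓕 (fun x => φ x * G x) ξ‖) ≤ A + ‖ξ‖ * B := by
    rw [← mul_assoc, ← sq]
    refine (hA ξ).trans (add_le_add le_rfl ?_)
    rw [Finset.mul_sum]
    exact Finset.sum_le_sum fun j _ =>
      mul_le_mul_of_nonneg_left (norm_fourier_le _ _) (norm_nonneg _)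
  -- Low frequencies use the L¹ bound `D`; high ones use `h1` divided by |ξ| ≥ 1.
  rcases le_total ‖ξ‖ 1 with h | h
  · nlinarith [norm_nonneg (𝓕 (fun x => φ x * G x) ξ)]
  · have hpos : 0 < ‖ξ‖ := by linarith
    refine le_of_mul_le_mul_left (h1.trans ?_) hpos
    nlinarith

/-- The Fourier transform of the truncated fundamental solution decays quadratically. -/
theorem IsOutgoingFundamentalSolution.exists_quadratic_decay
    (hG : IsOutgoingFundamentalSolution k G) {φ : E d → ℂ} (hφ : IsTest univ φ) :
    ∃ C, ∀ ξ : E d, ‖ξ‖ ^ 2 * ‖𝓕 (fun x => φ x * G x) ξ‖ ≤ C := by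
  obtain ⟨A, -, hA⟩ := hG.exists_sq_bound hφ
  choose C hC using fun j => hG.exists_linear_decay (hφ.partialDeriv j)
  exact ⟨A + ∑ j, C j, fun ξ =>
    (hA ξ).trans (add_le_add le_rfl (Finset.sum_le_sum fun j _ => hC j ξ))⟩

end FundamentalSolution

end AcousticVIE

namespace AcousticVIE

open scoped FourierTransform Convolution

variable {d : ℕ}

/-! ### Moving the convolution to the test function. -/

section AdjointPotential

/-- The transposed convolution `y ↦ ∫ K(x - y) φ(x) dx`. -/
def adjointPotential (K φ : E d → ℂ) (y : E d) : ℂ :=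
  ∫ x, K (x - y) * φ x

variable {K φ : E d → ℂ} {Ω : Set (E d)}

theorem adjointPotential_eq_convolution (K φ : E d → ℂ) :
    adjointPotential K φ = (fun z => K (-z)) ⋆[ContinuousLinearMap.mul ℝ ℂ] φ := by
  funext y
  rw [convolution_eq_swap]
  simp only [adjointPotential, neg_sub, ContinuousLinearMap.mul_apply']

theorem adjointPotential_eq_convolution_complex (K φ : E d → ℂ) :
    adjointPotential K φ = (fun z => K (-z)) ⋆[ContinuousLinearMap.mul ℂ ℂ] φ := by
  funext y
  rw [convolution_mul_swap]
  simp only [adjointPotential, neg_sub]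

/-- The support may spread beyond Ω, so the result is a test function on the whole space only. This
is why the product rule is later required for test functions on `univ`. -/
theorem isTest_adjointPotential (hK : Integrable K (volume : Measure (E d)))
    (hKc : HasCompactSupport K) (hφ : IsTest Ω φ) : IsTest univ (adjointPotential K φ) where
  contDiff := by
    rw [adjointPotential_eq_convolution]
    exact hφ.hasCompactSupport.contDiff_convolution_right _ hK.comp_neg.locallyIntegrable
      hφ.contDiff
  hasCompactSupport := by
    rw [adjointPotential_eq_convolution]
    exact HasCompactSupport.convolution _ (hKc.comp_homeomorph (Homeomorph.neg (E d)))
      hφ.hasCompactSupport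
  tsupport_subset := subset_univ _

theorem partialDeriv_convolution {f : E d → ℂ}
    (hf : LocallyIntegrable f (volume : Measure (E d))) (hφ : IsTest Ω φ) (j : Fin d) :
    partialDeriv j (f ⋆[ContinuousLinearMap.mul ℝ ℂ] φ)
      = f ⋆[ContinuousLinearMap.mul ℝ ℂ] (partialDeriv j φ) := by
  funext x
  have hφ1 : ContDiff ℝ 1 φ := hφ.contDiff.of_le (by simp)
  have h := hφ.hasCompactSupport.hasFDerivAt_convolution_right
    (ContinuousLinearMap.mul ℝ ℂ) hf hφ1 x
  unfold partialDeriv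
  rw [h.fderiv, convolution_precompR_apply _ hf (hφ.hasCompactSupport.fderiv ℝ)
    (hφ1.continuous_fderiv (by simp))]

theorem partialDeriv_adjointPotential (hK : Integrable K (volume : Measure (E d)))
    (hφ : IsTest Ω φ) (j : Fin d) :
    partialDeriv j (adjointPotential K φ) = adjointPotential K (partialDeriv j φ) := by
  rw [adjointPotential_eq_convolution, adjointPotential_eq_convolution,
    partialDeriv_convolution hK.comp_neg.locallyIntegrable hφ]

theorem planeWave_neg_neg (ξ x : E d) : planeWave ξ (-x) = planeWave (-ξ) x := by
  simp [planeWave]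

theorem fourier_comp_neg (f : E d → ℂ) (ξ : E d) :
    𝓕 (fun x => f (-x)) ξ = 𝓕 f (-ξ) := by
  rw [fourier_eq_integral_planeWave, fourier_eq_integral_planeWave, ← integral_neg_eq_self]
  simp only [planeWave_neg_neg, neg_neg]

theorem fourier_adjointPotential (hK : Integrable K (volume : Measure (E d)))
    (hφ : IsTest Ω φ) (ξ : E d) :
    𝓕 (adjointPotential K φ) ξ = 𝓕 K (-ξ) * 𝓕 φ ξ := by
  rw [adjointPotential_eq_convolution_complex,
    Real.fourier_mul_convolution_eq hK.comp_neg hφ.integrable, fourier_comp_neg]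

theorem fourier_partialDeriv (hφ : IsTest Ω φ) (j : Fin d) (ξ : E d) :
    𝓕 (partialDeriv j φ) ξ = 2 * Real.pi * Complex.I * (ξ j : ℂ) * 𝓕 φ ξ := by
  have hi : Integrable (fderiv ℝ φ) (volume : Measure (E d)) :=
    (hφ.contDiff.continuous_fderiv (by simp)).integrable_of_hasCompactSupport
      (hφ.hasCompactSupport.fderiv ℝ)
  have h := congrFun (Real.fourier_fderiv hφ.integrable hφ.differentiable hi) ξ
  have h2 : 𝓕 (fderiv ℝ φ) ξ (EuclideanSpace.single j (1 : ℝ)) = 𝓕 (partialDeriv j φ) ξ := by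
    rw [Real.fourier_eq, Real.fourier_eq, ContinuousLinearMap.integral_apply]
    · rfl
    · exact (Real.fourierIntegral_convergent_iff ξ).2 hi
  have h3 : innerSL ℝ ξ (EuclideanSpace.single j (1 : ℝ)) = ξ j := by
    rw [innerSL_apply_apply, EuclideanSpace.inner_single_right]
    simp
  rw [← h2, h]
  simp [h3, mul_assoc]

/-- Fubini's theorem. Both variables range over Ω, so `G` may be replaced by the integrable kernel
`K`, which makes the double integral absolutely convergent. -/
theorem integral_volumePotential_mul {G f : E d → ℂ} (hΩ : MeasurableSet Ω)
    (hK : Integrable K (volume : Measure (E d)))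
    (hKG : ∀ x ∈ Ω, ∀ y ∈ Ω, K (x - y) = G (x - y))
    (hf : IntegrableOn f Ω (volume : Measure (E d))) (hφ : IsTest Ω φ) :
    ∫ x in Ω, volumePotential Ω G f x * φ x = ∫ y in Ω, f y * adjointPotential K φ y := by
  have hF : Integrable (Ω.indicator f) (volume : Measure (E d)) := hf.integrable_indicator hΩ
  obtain ⟨C, hC⟩ := hφ.exists_bound
  have hI : Integrable (fun p : E d × E d => φ p.1 * (Ω.indicator f p.2 * K (p.1 - p.2)))
      ((volume : Measure (E d)).prod volume) :=
    (hF.convolution_integrand (ContinuousLinearMap.mul ℝ ℂ) hK).bdd_mul (c := C)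
      (hφ.continuous.comp continuous_fst).aestronglyMeasurable
      (Eventually.of_forall fun p => hC p.1)
  have h1 : ∀ x, x ∈ Ω → volumePotential Ω G f x * φ x
      = ∫ y, φ x * (Ω.indicator f y * K (x - y)) := by
    intro x hx
    rw [integral_const_mul, mul_comm, volumePotential, ← integral_indicator hΩ]
    congr 2
    funext y
    by_cases hy : y ∈ Ω
    · simp only [indicator_of_mem hy, hKG x hx y hy, mul_comm]
    · simp only [indicator_of_notMem hy, zero_mul]
  rw [setIntegral_congr_fun hΩ h1, setIntegral_eq_integral_of_forall_compl_eq_zero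
    (fun x hx => by simp [hφ.eq_zero_of_notMem hx]), integral_integral_swap hI,
    ← integral_indicator hΩ]
  congr 1
  funext y
  by_cases hy : y ∈ Ω
  · simp only [indicator_of_mem hy, adjointPotential, ← integral_const_mul]
    congr 1
    funext x
    ring
  · simp [indicator_of_notMem hy]

end AdjointPotential

end AcousticVIE

namespace AcousticVIE

open scoped FourierTransform ComplexConjugate

variable {d : ℕ}

/-! ### Fourier multipliers in L² and their transposes. -/

section L2Operators

/-- Multiplication by a bounded function as an operator in `L²`. -/
def mulL2 {X : Type*} [MeasurableSpace X] {μ : Measure X} {m : X → ℂ} (hm : MemLp m ∞ μ) :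
    Lp ℂ 2 μ →L[ℂ] Lp ℂ 2 μ :=
  (ContinuousLinearMap.mul ℂ ℂ).holderL μ ∞ 2 2 hm.toLp

theorem coeFn_mulL2 {X : Type*} [MeasurableSpace X] {μ : Measure X} {m : X → ℂ}
    (hm : MemLp m ∞ μ) (f : Lp ℂ 2 μ) : mulL2 hm f =ᵐ[μ] fun x => m x * f x := by
  have h := (ContinuousLinearMap.mul ℂ ℂ).coeFn_holder (r := 2) (hm.toLp) f
  filter_upwards [h, hm.coeFn_toLp] with x h1 h2
  rw [mulL2, ContinuousLinearMap.holderL_apply_apply, h1, h2]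
  rfl

variable {Ω : Set (E d)}

theorem IsTest.conj {φ : E d → ℂ} (hφ : IsTest Ω φ) : IsTest Ω (fun x => conj (φ x)) where
  contDiff := Complex.conjCLE.contDiff.comp hφ.contDiff
  hasCompactSupport := hφ.hasCompactSupport.comp_left (g := conj) (map_zero _)
  tsupport_subset :=
    (closure_mono (Function.support_comp_subset (map_zero conj) φ)).trans hφ.tsupport_subset

theorem conj_planeWave (ξ x : E d) : conj (planeWave ξ x) = planeWave (-ξ) x := by
  rw [planeWave, planeWave, ← Complex.exp_conj, map_mul, Complex.conj_ofReal, Complex.conj_I,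
    inner_neg_right]
  congr 1
  push_cast
  ring

theorem fourier_conj (f : E d → ℂ) (ξ : E d) :
    𝓕 (fun x => conj (f x)) ξ = conj (𝓕 f (-ξ)) := by
  rw [fourier_eq_integral_planeWave, fourier_eq_integral_planeWave, ← integral_conj]
  simp only [map_mul, conj_planeWave, neg_neg]

/-- The Fourier multiplier operator in `L²` with bounded symbol `m`. -/
def fourierMultiplierL2 {V : Type*} [NormedAddCommGroup V] [InnerProductSpace ℝ V]
    [FiniteDimensional ℝ V] [MeasurableSpace V] [BorelSpace V] {m : V → ℂ}
    (hm : MemLp m ∞ (volume : Measure V)) :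
    Lp ℂ 2 (volume : Measure V) →L[ℂ] Lp ℂ 2 (volume : Measure V) :=
  (FourierTransform.fourierInvCLM ℂ (Lp ℂ 2 (volume : Measure V))) ∘L mulL2 hm ∘L
    (FourierTransform.fourierCLM ℂ (Lp ℂ 2 (volume : Measure V)))

/-- Connects the L² Fourier transform with the pointwise integral formula, through Schwartz
functions, on which the two agree. -/
theorem fourierMultiplierL2_toLp {V : Type*} [NormedAddCommGroup V] [InnerProductSpace ℝ V]
    [FiniteDimensional ℝ V] [MeasurableSpace V] [BorelSpace V] {m : V → ℂ}
    (hm : MemLp m ∞ (volume : Measure V)) (Φ Ψ : SchwartzMap V ℂ)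
    (h : ∀ ξ, 𝓕 (Ψ : V → ℂ) ξ = m ξ * 𝓕 (Φ : V → ℂ) ξ) :
    fourierMultiplierL2 hm (Φ.toLp 2) = Ψ.toLp 2 := by
  have h3 : mulL2 hm (𝓕 (Φ.toLp 2 (volume : Measure V))) = 𝓕 (Ψ.toLp 2 (volume : Measure V)) := by
    rw [SchwartzMap.toLp_fourier_eq, SchwartzMap.toLp_fourier_eq]
    apply Lp.ext
    filter_upwards [coeFn_mulL2 hm ((𝓕 Φ).toLp 2), (𝓕 Φ).coeFn_toLp 2 volume,
      (𝓕 Ψ).coeFn_toLp 2 volume] with ξ e1 e2 e3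
    rw [e1, e2, e3, SchwartzMap.fourier_coe, SchwartzMap.fourier_coe, h]
  have h4 : fourierMultiplierL2 hm (Φ.toLp 2 (volume : Measure V))
      = 𝓕⁻ (mulL2 hm (𝓕 (Φ.toLp 2 (volume : Measure V)))) := rfl
  rw [h4, h3, FourierTransform.fourierInv_fourier_eq]

/-- The restriction to `Ω` of the adjoint of a Fourier multiplier operator. -/
def restrictedAdjoint {V : Type*} [NormedAddCommGroup V] [InnerProductSpace ℝ V]
    [FiniteDimensional ℝ V] [MeasurableSpace V] [BorelSpace V] {m : V → ℂ}
    (hm : MemLp m ∞ (volume : Measure V)) (U : Set V) :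
    Lp ℂ 2 ((volume : Measure V).restrict U) →L[ℂ] Lp ℂ 2 ((volume : Measure V).restrict U) :=
  (LpToLpRestrictCLM V ℂ ℂ (volume : Measure V) 2 U) ∘L
    (fourierMultiplierL2 hm).adjoint ∘L
    (LpToLpRestrictCLM V ℂ ℂ (volume : Measure V) 2 U).adjoint

/-- The multiplier maps Φ to Ψ, so both sides are the same L² inner product with the operator moved
across by its Hilbert adjoint. Since Φ vanishes off `U`, its integral over `U` is one over the whole
space. -/
theorem integral_restrictedAdjoint_mul {V : Type*} [NormedAddCommGroup V] [InnerProductSpace ℝ V]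
    [FiniteDimensional ℝ V] [MeasurableSpace V] [BorelSpace V] {m : V → ℂ}
    (hm : MemLp m ∞ (volume : Measure V)) {U : Set V} (Φ Ψ : SchwartzMap V ℂ)
    (h : ∀ ξ, 𝓕 (Ψ : V → ℂ) ξ = m ξ * 𝓕 (Φ : V → ℂ) ξ) (hΦ : ∀ x, x ∉ U → Φ x = 0)
    (f : Lp ℂ 2 ((volume : Measure V).restrict U)) :
    ∫ x in U, f x * conj (Ψ x) = ∫ x in U, restrictedAdjoint hm U f x * conj (Φ x) := by
  set R := LpToLpRestrictCLM V ℂ ℂ (volume : Measure V) 2 U with hR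
  set T := fourierMultiplierL2 hm with hT
  set g : Lp ℂ 2 (volume : Measure V) := T.adjoint (R.adjoint f) with hg
  have e1 : ∫ x in U, f x * conj (Ψ x) = inner ℂ (R (Ψ.toLp 2 (volume : Measure V))) f := by
    rw [L2.inner_def]
    refine integral_congr_ae ?_
    filter_upwards [LpToLpRestrictCLM_coeFn ℂ U (Ψ.toLp 2 (volume : Measure V)),
      ae_restrict_of_ae (Ψ.coeFn_toLp 2 (volume : Measure V))] with x h1 h2
    rw [h1, h2]
    simp
  have e2 : ∫ x in U, R g x * conj (Φ x) = inner ℂ (Φ.toLp 2 (volume : Measure V)) g := by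
    have e3 : ∫ x in U, R g x * conj (Φ x) = ∫ x in U, g x * conj (Φ x) := by
      refine integral_congr_ae ?_
      filter_upwards [LpToLpRestrictCLM_coeFn ℂ U g] with x h1
      rw [h1]
    rw [e3, L2.inner_def, setIntegral_eq_integral_of_forall_compl_eq_zero
      (fun x hx => by rw [hΦ x hx, map_zero, mul_zero])]
    refine integral_congr_ae ?_
    filter_upwards [Φ.coeFn_toLp 2 (volume : Measure V)] with x h2
    rw [h2]
    simp
  have e4 : restrictedAdjoint hm U f = R g := rfl
  rw [e1, e4, e2, hg, ContinuousLinearMap.adjoint_inner_right, hT,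
    fourierMultiplierL2_toLp hm Φ Ψ h, ContinuousLinearMap.adjoint_inner_right]

/-- A convolution operator on test functions with bounded symbol has a bounded transpose. -/
theorem exists_transpose (Ω : Set (E d)) {m : E d → ℂ} (hm : Continuous m) {C : ℝ}
    (hC : ∀ ξ, ‖m ξ‖ ≤ C) :
    ∃ S : L2 Ω →L[ℂ] L2 Ω, ∀ φ W : E d → ℂ, IsTest Ω φ → IsTest univ W →
      (∀ ξ, 𝓕 W ξ = m ξ * 𝓕 φ ξ) → ∀ f : L2 Ω,
        ∫ x in Ω, f x * W x = ∫ x in Ω, S f x * φ x := by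
  -- The pairing wanted is bilinear, while the adjoint is taken for a sesquilinear product. Hence φ
  -- and `W` are conjugated, and conjugation turns the symbol m(ξ) into the conjugate of m(−ξ).
  have hm' : MemLp (fun ξ => conj (m (-ξ))) ∞ (volume : Measure (E d)) :=
    memLp_top_of_bound (Complex.continuous_conj.comp (hm.comp continuous_neg)).aestronglyMeasurable
      C (Eventually.of_forall fun ξ => by simpa using hC (-ξ))
  refine ⟨restrictedAdjoint hm' Ω, fun φ W hφ hW hφW f => ?_⟩
  have key := integral_restrictedAdjoint_mul hm' (U := Ω)
    (hφ.conj.hasCompactSupport.toSchwartzMap hφ.conj.contDiff)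
    (hW.conj.hasCompactSupport.toSchwartzMap hW.conj.contDiff)
    (fun ξ => by
      change 𝓕 (fun x => conj (W x)) ξ = conj (m (-ξ)) * 𝓕 (fun x => conj (φ x)) ξ
      rw [fourier_conj, fourier_conj, hφW, map_mul])
    (fun x hx => by
      change conj (φ x) = 0
      rw [hφ.eq_zero_of_notMem hx, map_zero]) f
  simpa using key

end L2Operators

end AcousticVIE

namespace AcousticVIE

open scoped FourierTransform

variable {d : ℕ} {Ω : Set (E d)} {k : ℂ} {G : E d → ℂ}

/-! ### Bounded L² operators for the potential and its first and second derivatives. -/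

section PotentialOperators

theorem IsOutgoingFundamentalSolution.exists_truncation
    (hG : IsOutgoingFundamentalSolution k G) (hΩ : Bornology.IsBounded Ω) :
    ∃ K : E d → ℂ, Integrable K (volume : Measure (E d)) ∧ HasCompactSupport K ∧
      (∀ x ∈ Ω, ∀ y ∈ Ω, K (x - y) = G (x - y)) ∧
      ∃ C, ∀ ξ, ‖𝓕 K ξ‖ ≤ C ∧ ‖ξ‖ ^ 2 * ‖𝓕 K ξ‖ ≤ C := by
  obtain ⟨r, hr0, hr⟩ := hΩ.subset_ball_lt 0 0
  -- Ω lies in the ball of radius r, so Ω − Ω lies where the bump equals 1.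
  let f : ContDiffBump (0 : E d) := ⟨2 * r, 2 * r + 1, by linarith, by linarith⟩
  have hφ : IsTest univ (fun x => ((f x : ℝ) : ℂ)) :=
    { contDiff := Complex.ofRealCLM.contDiff.comp f.contDiff
      hasCompactSupport := f.hasCompactSupport.comp_left (g := ((↑) : ℝ → ℂ)) Complex.ofReal_zero
      tsupport_subset := subset_univ _ }
  obtain ⟨C, hC⟩ := hG.exists_quadratic_decay hφ
  refine ⟨fun x => (f x : ℂ) * G x, hφ.integrable_mul hG.locallyIntegrable,
    hφ.hasCompactSupport.mul_right, fun x hx y hy => ?_,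
    max (∫ x, ‖(f x : ℂ) * G x‖) C, fun ξ => ⟨(norm_fourier_le _ ξ).trans (le_max_left _ _),
      (hC ξ).trans (le_max_right _ _)⟩⟩
  have h1 : f (x - y) = 1 := by
    refine f.one_of_mem_closedBall ?_
    have hx' := mem_ball_zero_iff.1 (hr hx)
    have hy' := mem_ball_zero_iff.1 (hr hy)
    rw [mem_closedBall_zero_iff]
    change ‖x - y‖ ≤ 2 * r
    linarith [norm_sub_le x y]
  simp only [h1, Complex.ofReal_one, one_mul]

/-- The symbols are 𝓕K(−ξ) times a monomial of degree at most two in 2πiξ, all bounded by `hC`.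
Since these are transposes, `S₁ j` is minus the j-th derivative of the potential and `S₂ i j` is its
mixed second derivative. -/
theorem exists_potential_operators (Ω : Set (E d)) {K : E d → ℂ}
    (hK : Integrable K (volume : Measure (E d))) (hKc : HasCompactSupport K) {C : ℝ}
    (hC : ∀ ξ, ‖𝓕 K ξ‖ ≤ C ∧ ‖ξ‖ ^ 2 * ‖𝓕 K ξ‖ ≤ C) :
    ∃ (S₀ : L2 Ω →L[ℂ] L2 Ω) (S₁ : Fin d → L2 Ω →L[ℂ] L2 Ω)
      (S₂ : Fin d → Fin d → L2 Ω →L[ℂ] L2 Ω), ∀ (f : L2 Ω) (φ : E d → ℂ), IsTest Ω φ →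
        (∫ x in Ω, f x * adjointPotential K φ x = ∫ x in Ω, S₀ f x * φ x) ∧
        (∀ j, ∫ x in Ω, f x * adjointPotential K (partialDeriv j φ) x
          = ∫ x in Ω, S₁ j f x * φ x) ∧
        (∀ i j, ∫ x in Ω, f x * adjointPotential K (partialDeriv i (partialDeriv j φ)) x
          = ∫ x in Ω, S₂ i j f x * φ x) := by
  have hm : Continuous fun ξ : E d => 𝓕 K (-ξ) :=
    (VectorFourier.fourierIntegral_continuous Real.continuous_fourierChar
      (by exact continuous_inner) hK).comp continuous_neg
  have hm1 : ∀ j, Continuous fun ξ : E d =>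
      2 * Real.pi * Complex.I * (ξ j : ℂ) * 𝓕 K (-ξ) := fun j => by fun_prop
  have hm2 : ∀ i j, Continuous fun ξ : E d => 2 * Real.pi * Complex.I * (ξ i : ℂ)
      * (2 * Real.pi * Complex.I * (ξ j : ℂ) * 𝓕 K (-ξ)) := fun i j => by fun_prop
  have hn : ∀ (ξ : E d) (j : Fin d),
      ‖2 * (Real.pi : ℂ) * Complex.I * (ξ j : ℂ)‖ ≤ 2 * Real.pi * ‖ξ‖ := by
    intro ξ j
    have hj : |ξ j| ≤ ‖ξ‖ := by simpa using PiLp.norm_apply_le ξ j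
    simp only [norm_mul, Complex.norm_real, Complex.norm_ofNat, Complex.norm_I,
      Real.norm_eq_abs, abs_of_pos Real.pi_pos, mul_one]
    gcongr
  have hb0 : ∀ ξ : E d, ‖𝓕 K (-ξ)‖ ≤ C := fun ξ => (hC (-ξ)).1
  have hb2' : ∀ ξ : E d, ‖ξ‖ ^ 2 * ‖𝓕 K (-ξ)‖ ≤ C := fun ξ => by simpa using (hC (-ξ)).2
  -- Interpolates between the two bounds in `hC` by |ξ| ≤ 1 + |ξ|², whence 2C.
  have hb1 : ∀ j (ξ : E d), ‖2 * (Real.pi : ℂ) * Complex.I * (ξ j : ℂ) * 𝓕 K (-ξ)‖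
      ≤ 2 * Real.pi * (2 * C) := by
    intro j ξ
    rw [norm_mul]
    refine (mul_le_mul_of_nonneg_right (hn ξ j) (norm_nonneg _)).trans ?_
    rw [mul_assoc (2 * Real.pi)]
    refine mul_le_mul_of_nonneg_left ?_ (by positivity)
    have h1 := hb0 ξ
    have h2 := hb2' ξ
    nlinarith [mul_nonneg (sq_nonneg (‖ξ‖ - 1)) (norm_nonneg (𝓕 K (-ξ))),
      norm_nonneg (𝓕 K (-ξ))]
  have hb2 : ∀ i j (ξ : E d), ‖2 * (Real.pi : ℂ) * Complex.I * (ξ i : ℂ)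
      * (2 * Real.pi * Complex.I * (ξ j : ℂ) * 𝓕 K (-ξ))‖ ≤ (2 * Real.pi) ^ 2 * C := by
    intro i j ξ
    rw [norm_mul, norm_mul _ (𝓕 K (-ξ))]
    calc _ ≤ 2 * Real.pi * ‖ξ‖ * (2 * Real.pi * ‖ξ‖ * ‖𝓕 K (-ξ)‖) := by
          exact mul_le_mul (hn ξ i) (mul_le_mul_of_nonneg_right (hn ξ j) (norm_nonneg _))
            (by positivity) (by positivity)
      _ = (2 * Real.pi) ^ 2 * (‖ξ‖ ^ 2 * ‖𝓕 K (-ξ)‖) := by ring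
      _ ≤ _ := by
          gcongr
          exact hb2' ξ
  obtain ⟨S₀, h₀⟩ := exists_transpose Ω hm hb0
  choose S₁ h₁ using fun j => exists_transpose Ω (hm1 j) (hb1 j)
  choose S₂ h₂ using fun i j => exists_transpose Ω (hm2 i j) (hb2 i j)
  refine ⟨S₀, S₁, S₂, fun f φ hφ => ⟨?_, fun j => ?_, fun i j => ?_⟩⟩
  · exact h₀ φ _ hφ (isTest_adjointPotential hK hKc hφ)
      (fun ξ => fourier_adjointPotential hK hφ ξ) f
  · refine h₁ j φ _ hφ (isTest_adjointPotential hK hKc (hφ.partialDeriv j)) (fun ξ => ?_) f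
    rw [fourier_adjointPotential hK (hφ.partialDeriv j), fourier_partialDeriv hφ]
    ring
  · refine h₂ i j φ _ hφ
      (isTest_adjointPotential hK hKc ((hφ.partialDeriv j).partialDeriv i)) (fun ξ => ?_) f
    rw [fourier_adjointPotential hK ((hφ.partialDeriv j).partialDeriv i),
      fourier_partialDeriv (hφ.partialDeriv j), fourier_partialDeriv hφ]
    ring

end PotentialOperators

/-! ### Continuous functionals and maps between L² and H¹. -/

section Pairing

/-- The continuous linear functional `f ↦ ∫_Ω f ψ` on `L²(Ω)`. -/
def pairing {ψ : E d → ℂ} (hψ : MemLp ψ 2 ((volume : Measure (E d)).restrict Ω)) :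
    L2 Ω →L[ℂ] ℂ :=
  ((ContinuousLinearMap.mul ℂ ℂ).lpPairing ((volume : Measure (E d)).restrict Ω) 2 2).flip
    hψ.toLp

theorem pairing_apply {ψ : E d → ℂ} (hψ : MemLp ψ 2 ((volume : Measure (E d)).restrict Ω))
    (f : L2 Ω) : pairing hψ f = ∫ x in Ω, f x * ψ x := by
  rw [pairing, ContinuousLinearMap.flip_apply, ContinuousLinearMap.lpPairing_eq_integral]
  refine integral_congr_ae ?_
  filter_upwards [hψ.coeFn_toLp] with x hx
  rw [hx]
  rfl

theorem IsTest.memLp {U : Set (E d)} {φ : E d → ℂ} (hφ : IsTest U φ) (Ω : Set (E d)) :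
    MemLp φ 2 ((volume : Measure (E d)).restrict Ω) :=
  hφ.continuous.memLp_of_hasCompactSupport hφ.hasCompactSupport

/-- The embedding `H¹(Ω) → L²(Ω)` as a continuous linear map. -/
def toL2CLM (Ω : Set (E d)) : H1 Ω →L[ℂ] L2 Ω :=
  WithLp.fstL 2 ℂ (L2 Ω) (PiLp 2 fun _ : Fin d => L2 Ω) ∘L (H1 Ω).subtypeL

theorem toL2CLM_apply (u : H1 Ω) : toL2CLM Ω u = toL2 u := rfl

/-- The weak partial derivative `H¹(Ω) → L²(Ω)` as a continuous linear map. -/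
def gradCLM (Ω : Set (E d)) (j : Fin d) : H1 Ω →L[ℂ] L2 Ω :=
  PiLp.proj 2 (fun _ : Fin d => L2 Ω) j ∘L
    WithLp.sndL 2 ℂ (L2 Ω) (PiLp 2 fun _ : Fin d => L2 Ω) ∘L (H1 Ω).subtypeL

theorem gradCLM_apply (u : H1 Ω) (j : Fin d) : gradCLM Ω j u = grad u j := rfl

theorem hasWeakGradient_H1 (u : H1 Ω) :
    HasWeakGradient Ω (toL2 u : E d → ℂ) (fun j => (grad u j : E d → ℂ)) := u.2

/-- A continuous linear map into `L²(Ω)` with weak gradient in `L²(Ω)` defines a continuous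
linear map into `H¹(Ω)`. -/
theorem exists_H1_lift {V : Type*} [NormedAddCommGroup V] [NormedSpace ℂ V]
    (T : V →L[ℂ] L2 Ω) (T' : Fin d → V →L[ℂ] L2 Ω)
    (h : ∀ v, HasWeakGradient Ω (T v : E d → ℂ) (fun j => (T' j v : E d → ℂ))) :
    ∃ A : V →L[ℂ] H1 Ω, ∀ v, toL2 (A v) = T v := by
  let B : V →L[ℂ] WithLp 2 (L2 Ω × PiLp 2 fun _ : Fin d => L2 Ω) :=
    ((WithLp.prodContinuousLinearEquiv 2 ℂ (L2 Ω) (PiLp 2 fun _ : Fin d => L2 Ω)).symm :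
      (L2 Ω × PiLp 2 fun _ : Fin d => L2 Ω) →L[ℂ] WithLp 2 (L2 Ω × PiLp 2 fun _ : Fin d => L2 Ω))
      ∘L T.prod (((PiLp.continuousLinearEquiv 2 ℂ fun _ : Fin d => L2 Ω).symm :
        (Fin d → L2 Ω) →L[ℂ] PiLp 2 fun _ : Fin d => L2 Ω) ∘L ContinuousLinearMap.pi T')
  exact ⟨B.codRestrict (H1 Ω) h, fun v => rfl⟩

end Pairing

end AcousticVIE

namespace AcousticVIE

variable {d : ℕ} {Ω : Set (E d)} {G K α β : E d → ℂ}

/-! ### The operator on H¹, and on L² given the product rule. -/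

section VolumeOperator

theorem volumePotential_congr {f f' : E d → ℂ}
    (h : f =ᵐ[(volume : Measure (E d)).restrict Ω] f') (x : E d) :
    volumePotential Ω G f x = volumePotential Ω G f' x := by
  refine integral_congr_ae ?_
  filter_upwards [h] with y hy
  rw [hy]

/-- The weak form of the volume operator, with the convolutions moved to the test function. -/
theorem volumeOperator_eq (hΩ : MeasurableSet Ω) (hΩb : Bornology.IsBounded Ω)
    (hK : Integrable K (volume : Measure (E d)))
    (hKG : ∀ x ∈ Ω, ∀ y ∈ Ω, K (x - y) = G (x - y))
    (hα : MemLp α ∞ ((volume : Measure (E d)).restrict Ω))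
    (hβ : MemLp β ∞ ((volume : Measure (E d)).restrict Ω)) (u : H1 Ω) {φ : E d → ℂ}
    (hφ : IsTest Ω φ) :
    volumeOperator Ω G α β u φ
      = -(∑ j, ∫ x in Ω, mulL2 hα (grad u j) x * adjointPotential K (partialDeriv j φ) x)
        + ∫ x in Ω, mulL2 hβ (toL2 u) x * adjointPotential K φ x := by
  have : IsFiniteMeasure ((volume : Measure (E d)).restrict Ω) :=
    ⟨by simpa using hΩb.measure_lt_top⟩
  have hi : ∀ f : L2 Ω, IntegrableOn f Ω (volume : Measure (E d)) := fun f =>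
    (Lp.memLp f).integrable (by norm_num)
  have h1 : ∀ j x, volumePotential Ω G (fun y => α y * grad u j y) x
      = volumePotential Ω G (mulL2 hα (grad u j)) x := fun j x =>
    volumePotential_congr (coeFn_mulL2 hα (grad u j)).symm x
  have h2 : ∀ x, volumePotential Ω G (fun y => β y * toL2 u y) x
      = volumePotential Ω G (mulL2 hβ (toL2 u)) x := fun x =>
    volumePotential_congr (coeFn_mulL2 hβ (toL2 u)).symm x
  unfold volumeOperator
  simp_rw [h1, h2]
  rw [integral_volumePotential_mul hΩ hK hKG (hi _) hφ]
  simp_rw [fun j => integral_volumePotential_mul hΩ hK hKG (hi (mulL2 hα (grad u j)))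
    (hφ.partialDeriv j)]

theorem pairing_eq_iff {φ ψ : E d → ℂ} (hφ : MemLp φ 2 ((volume : Measure (E d)).restrict Ω))
    (hψ : MemLp ψ 2 ((volume : Measure (E d)).restrict Ω)) (f g : L2 Ω) :
    pairing hφ f = pairing hψ g ↔ ∫ x in Ω, f x * φ x = ∫ x in Ω, g x * ψ x := by
  rw [pairing_apply, pairing_apply]

/-- `u ∈ H¹(Ω)` satisfies the product rule `∂_j (α u) = α ∂_j u + g_j u` on the whole space, all
functions being extended by zero. -/
def HasProductRule (hα : MemLp α ∞ ((volume : Measure (E d)).restrict Ω))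
    {g : Fin d → E d → ℂ} (hg : ∀ j, MemLp (g j) ∞ ((volume : Measure (E d)).restrict Ω))
    (u : H1 Ω) : Prop :=
  ∀ (ψ : E d → ℂ) (hψ : IsTest univ ψ) (j : Fin d),
    pairing ((hψ.partialDeriv j).memLp Ω) (mulL2 hα (toL2 u))
      = -(pairing (hψ.memLp Ω) (mulL2 hα (grad u j) + mulL2 (hg j) (toL2 u)))

theorem exists_H1_operator (hΩ : MeasurableSet Ω) (hΩb : Bornology.IsBounded Ω) {k : ℂ}
    (hG : IsOutgoingFundamentalSolution k G)
    (hα : MemLp α ∞ ((volume : Measure (E d)).restrict Ω))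
    (hβ : MemLp β ∞ ((volume : Measure (E d)).restrict Ω)) :
    ∃ A : H1 Ω →L[ℂ] H1 Ω, ∀ u : H1 Ω, VolumeOperatorEq Ω G α β u (toL2 (A u)) := by
  obtain ⟨K, hK, hKc, hKG, C, hC⟩ := hG.exists_truncation hΩb
  obtain ⟨S₀, S₁, S₂, hS⟩ := exists_potential_operators Ω hK hKc hC
  let T : H1 Ω →L[ℂ] L2 Ω :=
    -(∑ j, S₁ j ∘L mulL2 hα ∘L gradCLM Ω j) + S₀ ∘L mulL2 hβ ∘L toL2CLM Ω
  -- The candidate for ∂_l T: each further weak derivative changes sign, so −S₁ becomes S₂ and S₀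
  -- becomes −S₁.
  let T' : Fin d → H1 Ω →L[ℂ] L2 Ω := fun l =>
    (∑ j, S₂ j l ∘L mulL2 hα ∘L gradCLM Ω j) - S₁ l ∘L mulL2 hβ ∘L toL2CLM Ω
  have hT : ∀ u, T u = -(∑ j, S₁ j (mulL2 hα (grad u j))) + S₀ (mulL2 hβ (toL2 u)) := fun u => by
    simp [T, toL2CLM_apply, gradCLM_apply]
  have hT' : ∀ l u, T' l u
      = (∑ j, S₂ j l (mulL2 hα (grad u j))) - S₁ l (mulL2 hβ (toL2 u)) := fun l u => by
    simp [T', toL2CLM_apply, gradCLM_apply]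
  obtain ⟨A, hA⟩ := exists_H1_lift T T' fun u φ hφ l => by
    have hφl := hφ.partialDeriv l
    -- Using ∂_lφ as the test function for one potential operator is using φ for the next. Since all
    -- operators come from the same `K`, their weak derivatives are known without further analysis.
    have h0 : ∀ f : L2 Ω, pairing (hφl.memLp Ω) (S₀ f) = pairing (hφ.memLp Ω) (S₁ l f) :=
      fun f => by
        rw [pairing_eq_iff, ← (hS f _ hφl).1, ← (hS f _ hφ).2.1 l]
    have h1 : ∀ j (f : L2 Ω), pairing (hφl.memLp Ω) (S₁ j f)
        = pairing (hφ.memLp Ω) (S₂ j l f) := fun j f => by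
      rw [pairing_eq_iff, ← (hS f _ hφl).2.1 j, ← (hS f _ hφ).2.2 j l]
    rw [← pairing_apply (hφl.memLp Ω), ← pairing_apply (hφ.memLp Ω), hT, hT']
    simp only [map_add, map_neg, map_sub, map_sum, h0, h1]
    ring
  refine ⟨A, fun u φ hφ => ?_⟩
  rw [volumeOperator_eq hΩ hΩb hK hKG hα hβ u hφ, ← pairing_apply (hφ.memLp Ω), hA, hT]
  simp only [map_add, map_neg, map_sum, pairing_apply, (hS _ φ hφ).1, (hS _ φ hφ).2.1]

theorem exists_L2_operator (hΩ : MeasurableSet Ω) (hΩb : Bornology.IsBounded Ω) {k : ℂ}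
    (hG : IsOutgoingFundamentalSolution k G)
    (hα : MemLp α ∞ ((volume : Measure (E d)).restrict Ω))
    (hβ : MemLp β ∞ ((volume : Measure (E d)).restrict Ω)) {g : Fin d → E d → ℂ}
    (hg : ∀ j, MemLp (g j) ∞ ((volume : Measure (E d)).restrict Ω)) :
    ∃ A : L2 Ω →L[ℂ] L2 Ω, ∀ u : H1 Ω, HasProductRule hα hg u →
      VolumeOperatorEq Ω G α β u (A (toL2 u)) := by
  obtain ⟨K, hK, hKc, hKG, C, hC⟩ := hG.exists_truncation hΩb
  obtain ⟨S₀, S₁, S₂, hS⟩ := exists_potential_operators Ω hK hKc hC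
  -- Obtained by inserting α ∂_j u = ∂_j(αu) − g_j u and integrating by parts: the second kernel
  -- derivative falls on αu, the first on g_j u.
  let A : L2 Ω →L[ℂ] L2 Ω :=
    (∑ j, (S₂ j j ∘L mulL2 hα + S₁ j ∘L mulL2 (hg j))) + S₀ ∘L mulL2 hβ
  have hA : ∀ v, A v = (∑ j, (S₂ j j (mulL2 hα v) + S₁ j (mulL2 (hg j) v)))
      + S₀ (mulL2 hβ v) := fun v => by
    simp [A]
  refine ⟨A, fun u hu φ hφ => ?_⟩
  rw [volumeOperator_eq hΩ hΩb hK hKG hα hβ u hφ, ← pairing_apply (hφ.memLp Ω), hA]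
  have h1 : ∀ j, ∫ x in Ω, mulL2 hα (grad u j) x * adjointPotential K (partialDeriv j φ) x
      = -(pairing (hφ.memLp Ω) (S₂ j j (mulL2 hα (toL2 u)))
        + pairing (hφ.memLp Ω) (S₁ j (mulL2 (hg j) (toL2 u)))) := by
    intro j
    -- The product rule is tested with the convolution of ∂_jφ; one more ∂_j commutes with the
    -- convolution and produces `S₂ j j`.
    have hW := isTest_adjointPotential hK hKc (hφ.partialDeriv j)
    have h2 := hu _ hW j
    rw [map_add] at h2
    rw [pairing_apply (hφ.memLp Ω), pairing_apply (hφ.memLp Ω), ← (hS _ φ hφ).2.1,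
      ← (hS _ φ hφ).2.2, ← partialDeriv_adjointPotential hK (hφ.partialDeriv j),
      ← pairing_apply (hW.memLp Ω), ← pairing_apply ((hW.partialDeriv j).memLp Ω),
      ← pairing_apply (hW.memLp Ω), h2]
    ring
  simp_rw [h1]
  rw [(hS _ φ hφ).1]
  simp only [map_add, map_sum, pairing_apply, Finset.sum_neg_distrib, neg_neg]

end VolumeOperator

end AcousticVIE

namespace AcousticVIE

variable {d : ℕ} {Ω : Set (E d)} {α : E d → ℂ}

/-! ### The product rule on H¹₀. -/

section ProductRule

theorem integral_mul_partialDeriv {U : Set (E d)} {φ η : E d → ℂ} (hφ : IsTest U φ)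
    (hη : IsTest U η) (j : Fin d) :
    ∫ x, φ x * partialDeriv j η x = -∫ x, partialDeriv j φ x * η x :=
  integral_mul_fderiv_eq_neg_fderiv_mul_of_integrable
    ((hη.mul_left (hφ.partialDeriv j).contDiff).integrable)
    (((hη.partialDeriv j).mul_left hφ.contDiff).integrable)
    ((hη.mul_left hφ.contDiff).integrable)
    (fun x _ => hφ.differentiable x) (fun x _ => hη.differentiable x)

theorem IsTest.setIntegral_mul {φ : E d → ℂ} (hφ : IsTest Ω φ) (f : E d → ℂ) :
    ∫ x in Ω, f x * φ x = ∫ x, f x * φ x :=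
  setIntegral_eq_integral_of_forall_compl_eq_zero
    fun x hx => by rw [hφ.eq_zero_of_notMem hx, mul_zero]

theorem IsTest.integrable_mul_memLp_top {U : Set (E d)} {φ f : E d → ℂ} (hφ : IsTest U φ)
    (hf : MemLp f ∞ ((volume : Measure (E d)).restrict Ω)) :
    Integrable (fun x => f x * φ x) ((volume : Measure (E d)).restrict Ω) :=
  hf.integrable_mul (q := 1) (memLp_one_iff_integrable.2 hφ.integrable.restrict)

/-- Uniqueness of weak gradients. The generators of `H10` are specified by their L² component alone,
so their gradient component has to be identified. -/
theorem grad_ae_eq_partialDeriv (hΩ : IsOpen Ω) (u : H1 Ω) {φ : E d → ℂ} (hφ : IsTest Ω φ)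
    (hu : (toL2 u : E d → ℂ) =ᵐ[(volume : Measure (E d)).restrict Ω] φ) (j : Fin d) :
    (grad u j : E d → ℂ) =ᵐ[(volume : Measure (E d)).restrict Ω] partialDeriv j φ := by
  have hf : MemLp (fun x => grad u j x - partialDeriv j φ x) 2
      ((volume : Measure (E d)).restrict Ω) :=
    (Lp.memLp _).sub ((hφ.partialDeriv j).memLp Ω)
  have key := hΩ.ae_eq_zero_of_integral_contDiff_smul_eq_zero
    (μ := (volume : Measure (E d)).restrict Ω)
    ((hf.locallyIntegrable (by norm_num)).locallyIntegrableOn Ω) (fun η hη hηc hηs => by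
      have hη' : IsTest Ω (fun x => ((η x : ℝ) : ℂ)) :=
        { contDiff := Complex.ofRealCLM.contDiff.comp hη
          hasCompactSupport := hηc.comp_left (g := ((↑) : ℝ → ℂ)) Complex.ofReal_zero
          tsupport_subset :=
            (closure_mono (Function.support_comp_subset Complex.ofReal_zero η)).trans hηs }
      have h1 := hasWeakGradient_H1 u _ hη' j
      have h2 : ∫ x in Ω, toL2 u x * partialDeriv j (fun x => ((η x : ℝ) : ℂ)) x
          = ∫ x in Ω, φ x * partialDeriv j (fun x => ((η x : ℝ) : ℂ)) x := by
        refine integral_congr_ae ?_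
        filter_upwards [hu] with x hx
        rw [hx]
      rw [h2, (hη'.partialDeriv j).setIntegral_mul, integral_mul_partialDeriv hφ hη' j,
        ← hη'.setIntegral_mul, neg_inj] at h1
      have h3 : ∀ x, η x • (grad u j x - partialDeriv j φ x)
          = grad u j x * (η x : ℂ) - partialDeriv j φ x * (η x : ℂ) := fun x => by
        rw [Complex.real_smul]
        ring
      simp_rw [h3]
      rw [integral_sub, h1, sub_self]
      · exact (Lp.memLp (grad u j)).integrable_mul (q := 2) (hη'.memLp Ω)
      · exact (hη'.mul_left (hφ.partialDeriv j).contDiff).integrable.restrict)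
  filter_upwards [key, ae_restrict_mem hΩ.measurableSet] with x h1 h2
  exact sub_eq_zero.1 (h1 h2)

/-- For fixed ψ and j, both sides are continuous functionals of u in the H¹ norm. -/
theorem isClosed_hasProductRule (hα : MemLp α ∞ ((volume : Measure (E d)).restrict Ω))
    {g : Fin d → E d → ℂ} (hg : ∀ j, MemLp (g j) ∞ ((volume : Measure (E d)).restrict Ω)) :
    IsClosed {u : H1 Ω | HasProductRule hα hg u} := by
  simp only [HasProductRule, Set.ofPred_forall, ← toL2CLM_apply, ← gradCLM_apply]
  refine isClosed_iInter fun ψ => isClosed_iInter fun hψ => isClosed_iInter fun j =>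
    isClosed_eq ?_ ?_
  · exact (pairing _ ∘L mulL2 hα ∘L toL2CLM Ω).continuous
  · exact (-(pairing (hψ.memLp Ω) ∘L (mulL2 hα ∘L gradCLM Ω j + mulL2 (hg j) ∘L toL2CLM Ω))).continuous

theorem hasProductRule_iff (hα : MemLp α ∞ ((volume : Measure (E d)).restrict Ω))
    {g : Fin d → E d → ℂ} (hg : ∀ j, MemLp (g j) ∞ ((volume : Measure (E d)).restrict Ω))
    (u : H1 Ω) :
    HasProductRule hα hg u ↔ ∀ ψ : E d → ℂ, IsTest univ ψ → ∀ j : Fin d,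
      ∫ x in Ω, α x * toL2 u x * partialDeriv j ψ x
        = -∫ x in Ω, (α x * grad u j x + g j x * toL2 u x) * ψ x := by
  refine forall_congr' fun ψ => forall_congr' fun hψ => forall_congr' fun j => ?_
  rw [pairing_apply, pairing_apply]
  have h1 : ∫ x in Ω, mulL2 hα (toL2 u) x * partialDeriv j ψ x
      = ∫ x in Ω, α x * toL2 u x * partialDeriv j ψ x := by
    refine integral_congr_ae ?_
    filter_upwards [coeFn_mulL2 hα (toL2 u)] with x h1
    rw [h1]
  have h2 : ∫ x in Ω, (mulL2 hα (grad u j) + mulL2 (hg j) (toL2 u)) x * ψ x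
      = ∫ x in Ω, (α x * grad u j x + g j x * toL2 u x) * ψ x := by
    refine integral_congr_ae ?_
    filter_upwards [Lp.coeFn_add (mulL2 hα (grad u j)) (mulL2 (hg j) (toL2 u)),
      coeFn_mulL2 hα (grad u j), coeFn_mulL2 (hg j) (toL2 u)] with x h1 h2 h3
    rw [h1, Pi.add_apply, h2, h3]
  rw [h1, h2]

/-- By closedness it suffices to treat u = φ in C_c^∞(Ω). For any ψ on the whole space, φψ is then a
test function on Ω, so the gradient of α inside Ω is all that is needed. -/
theorem hasProductRule_of_mem_H10 (hΩ : IsOpen Ω)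
    (hα : MemLp α ∞ ((volume : Measure (E d)).restrict Ω))
    {g : Fin d → E d → ℂ} (hg : ∀ j, MemLp (g j) ∞ ((volume : Measure (E d)).restrict Ω))
    (hαg : HasWeakGradient Ω α g) {u : H1 Ω} (hu : u ∈ H10 Ω) : HasProductRule hα hg u := by
  refine closure_minimal (t := {u : H1 Ω | HasProductRule hα hg u}) ?_
    (isClosed_hasProductRule hα hg) hu
  rintro v ⟨φ, hφ, hv⟩
  refine (hasProductRule_iff hα hg v).2 fun ψ hψ j => ?_
  have hφψ : IsTest Ω (fun x => φ x * ψ x) := hφ.mul_right hψ.contDiff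
  have h1 := hαg _ hφψ j
  simp_rw [partialDeriv_mul hφ.differentiable hψ.differentiable, mul_add] at h1
  have i1 : IsTest Ω (fun x => φ x * partialDeriv j ψ x) := hφ.mul_right (hψ.partialDeriv j).contDiff
  have i2 : IsTest Ω (fun x => partialDeriv j φ x * ψ x) := (hφ.partialDeriv j).mul_right hψ.contDiff
  rw [integral_add (i1.integrable_mul_memLp_top hα) (i2.integrable_mul_memLp_top hα)] at h1
  have h2 : ∫ x in Ω, α x * toL2 v x * partialDeriv j ψ x
      = ∫ x in Ω, α x * (φ x * partialDeriv j ψ x) := by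
    refine integral_congr_ae ?_
    filter_upwards [hv] with x hx
    rw [hx, mul_assoc]
  have h3 : ∫ x in Ω, (α x * grad v j x + g j x * toL2 v x) * ψ x
      = ∫ x in Ω, (α x * (partialDeriv j φ x * ψ x) + g j x * (φ x * ψ x)) := by
    refine integral_congr_ae ?_
    filter_upwards [hv, grad_ae_eq_partialDeriv hΩ v hφ hv j] with x h1 h2
    rw [h1, h2]
    ring
  rw [h2, h3, integral_add (i2.integrable_mul_memLp_top hα) (hφψ.integrable_mul_memLp_top (hg j))]
  linear_combination h1

end ProductRule

end AcousticVIE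

namespace AcousticVIE

open scoped Convolution

variable {d : ℕ}

/-! ### Mollification of functions with bounded weak gradient. -/

section Mollification

/-- The mollification of `f` by a normalized bump function. -/
def mollify (ρ : ContDiffBump (0 : E d)) (f : E d → ℂ) : E d → ℂ :=
  ρ.normed volume ⋆[ContinuousLinearMap.lsmul ℝ ℝ, volume] f

variable (ρ : ContDiffBump (0 : E d)) {f : E d → ℂ}

theorem isTest_normed : IsTest univ (fun x => ((ρ.normed volume x : ℝ) : ℂ)) where
  contDiff := Complex.ofRealCLM.contDiff.comp ρ.contDiff_normed
  hasCompactSupport :=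
    ρ.hasCompactSupport_normed.comp_left (g := ((↑) : ℝ → ℂ)) Complex.ofReal_zero
  tsupport_subset := subset_univ _

theorem mollify_apply (f : E d → ℂ) (x : E d) :
    mollify ρ f x = ∫ t, (ρ.normed volume t : ℂ) * f (x - t) := rfl

theorem mollify_eq_convolution (f : E d → ℂ) :
    mollify ρ f
      = f ⋆[ContinuousLinearMap.mul ℝ ℂ] (fun x => ((ρ.normed volume x : ℝ) : ℂ)) := by
  funext x
  rw [convolution_eq_swap, mollify_apply]
  simp only [ContinuousLinearMap.mul_apply', mul_comm]

theorem contDiff_mollify (hf : LocallyIntegrable f (volume : Measure (E d))) :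
    ContDiff ℝ ∞ (mollify ρ f) := by
  rw [mollify_eq_convolution]
  exact (isTest_normed ρ).hasCompactSupport.contDiff_convolution_right _ hf
    (isTest_normed ρ).contDiff

theorem norm_mollify_le {C : ℝ} (hf : ∀ᵐ x, ‖f x‖ ≤ C) (x : E d) : ‖mollify ρ f x‖ ≤ C := by
  rw [mollify_apply]
  have h1 : ∀ᵐ t, ‖(ρ.normed volume t : ℂ) * f (x - t)‖ ≤ ρ.normed volume t * C := by
    have := (quasiMeasurePreserving_sub_left (volume : Measure (E d)) x).ae hf
    filter_upwards [this] with t ht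
    rw [norm_mul, Complex.norm_real, Real.norm_of_nonneg (ρ.nonneg_normed t)]
    exact mul_le_mul_of_nonneg_left ht (ρ.nonneg_normed t)
  refine (norm_integral_le_of_norm_le (ρ.integrable_normed.mul_const C) h1).trans_eq ?_
  rw [integral_mul_const, ρ.integral_normed, one_mul]

theorem partialDeriv_comp_sub {ψ : E d → ℂ} (hψ : Differentiable ℝ ψ) (j : Fin d) (x t : E d) :
    partialDeriv j (fun t => ψ (x - t)) t = -partialDeriv j ψ (x - t) := by
  have h := (hψ (x - t)).hasFDerivAt.comp t ((hasFDerivAt_id t).const_sub x)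
  have h' : fderiv ℝ (fun t => ψ (x - t)) t = _ := h.fderiv
  unfold partialDeriv
  rw [h']
  simp

/-- The weak gradient is tested with t ↦ ρ(x − t); the sign from the reflection cancels the one from
integration by parts. -/
theorem partialDeriv_mollify (hf : LocallyIntegrable f (volume : Measure (E d)))
    {g : Fin d → E d → ℂ} (hg : HasWeakGradient univ f g) (j : Fin d) :
    partialDeriv j (mollify ρ f) = mollify ρ (g j) := by
  have hρ := isTest_normed ρ
  funext x
  rw [mollify_eq_convolution, mollify_eq_convolution, partialDeriv_convolution hf hρ]
  have hx : IsTest univ (fun t => ((ρ.normed volume (x - t) : ℝ) : ℂ)) :=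
    { contDiff := hρ.contDiff.comp (contDiff_const.sub contDiff_id)
      hasCompactSupport := hρ.hasCompactSupport.comp_homeomorph (Homeomorph.subLeft x)
      tsupport_subset := subset_univ _ }
  have h1 := hg _ hx j
  simp only [partialDeriv_comp_sub hρ.differentiable, Measure.restrict_univ, mul_neg,
    integral_neg, neg_inj] at h1
  exact h1

theorem norm_mollify_sub_le {K : ℝ≥0} (hf : LipschitzWith K f) (x y : E d) :
    ‖mollify ρ f x - mollify ρ f y‖ ≤ K * ‖x - y‖ := by
  have hi : ∀ x, Integrable (fun t => (ρ.normed volume t : ℂ) * f (x - t))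
      (volume : Measure (E d)) := fun x =>
    (((isTest_normed ρ).continuous.mul
      (hf.continuous.comp (continuous_const.sub continuous_id))).integrable_of_hasCompactSupport
        (isTest_normed ρ).hasCompactSupport.mul_right)
  rw [mollify_apply, mollify_apply, ← integral_sub (hi x) (hi y)]
  refine (norm_integral_le_of_norm_le (ρ.integrable_normed.mul_const (K * ‖x - y‖))
    (Eventually.of_forall fun t => ?_)).trans_eq ?_
  · rw [← mul_sub, norm_mul, Complex.norm_real, Real.norm_of_nonneg (ρ.nonneg_normed t)]
    refine mul_le_mul_of_nonneg_left ?_ (ρ.nonneg_normed t)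
    simpa [dist_eq_norm] using hf.dist_le_mul (x - t) (y - t)
  · rw [integral_mul_const, ρ.integral_normed, one_mul]

theorem mollify_eq_of_ball {x : E d} (h : ∀ y ∈ Metric.ball x ρ.rOut, f y = f x) :
    mollify ρ f x = f x :=
  ρ.normed_convolution_eq_right h

/-- A sequence of mollifiers concentrating at the origin. -/
def mollifier (d n : ℕ) : ContDiffBump (0 : E d) :=
  ⟨1 / (n + 1), 2 * (1 / (n + 1)), by positivity, by
    have : (0 : ℝ) < 1 / (n + 1) := by positivity
    linarith⟩

theorem tendsto_mollifier_rOut (d : ℕ) :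
    Tendsto (fun n => (mollifier d n).rOut) atTop (𝓝 0) := by
  simpa [mollifier] using (tendsto_one_div_add_atTop_nhds_zero_nat (𝕜 := ℝ)).const_mul 2

theorem ae_tendsto_mollify (hf : LocallyIntegrable f (volume : Measure (E d))) :
    ∀ᵐ x, Tendsto (fun n => mollify (mollifier d n) f x) atTop (𝓝 (f x)) :=
  -- Lebesgue differentiation needs the ratio of outer to inner radius bounded; `mollifier` fixes it
  -- at 2.
  ContDiffBump.ae_convolution_tendsto_right_of_locallyIntegrable (K := 2)
    (tendsto_mollifier_rOut d) (Eventually.of_forall fun _ => le_rfl) hf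

theorem norm_sub_le_of_norm_partialDeriv_le {φ : E d → ℂ} (hφ : Differentiable ℝ φ) {C : Fin d → ℝ}
    (hC : ∀ j x, ‖partialDeriv j φ x‖ ≤ C j) (x y : E d) :
    ‖φ x - φ y‖ ≤ (∑ j, C j) * ‖x - y‖ := by
  refine Convex.norm_image_sub_le_of_norm_fderiv_le (𝕜 := ℝ) (fun z _ => hφ z) (fun z _ => ?_)
    convex_univ (mem_univ y) (mem_univ x)
  have hC0 : 0 ≤ ∑ j, C j := Finset.sum_nonneg fun j _ => (norm_nonneg _).trans (hC j z)
  refine ContinuousLinearMap.opNorm_le_bound _ hC0 fun v => ?_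
  have hv : v = ∑ j, v j • EuclideanSpace.single j (1 : ℝ) := by
    have := (EuclideanSpace.basisFun (Fin d) ℝ).sum_repr v
    simpa using this.symm
  have h1 : fderiv ℝ φ z v = ∑ j, v j • partialDeriv j φ z := by
    conv_lhs => rw [hv]
    rw [map_sum]
    exact Finset.sum_congr rfl fun j _ => map_smul _ _ _
  rw [h1, Finset.sum_mul]
  refine (norm_sum_le _ _).trans (Finset.sum_le_sum fun j _ => ?_)
  rw [norm_smul, mul_comm]
  exact mul_le_mul (hC j z) (PiLp.norm_apply_le v j) (norm_nonneg _)
    ((norm_nonneg _).trans (hC j z))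

end Mollification

end AcousticVIE

namespace AcousticVIE

variable {d : ℕ} {Ω : Set (E d)} {α : E d → ℂ}

/-! ### Decay of α towards the boundary. -/

section Boundary

/-- The Lipschitz boundary enters here. A point of Ωᶜ on the frontier lies on or below the local
graph; a small move along −e keeps the base point and lands strictly below it, in an open set
disjoint from Ω. -/
theorem IsBoundedLipschitzDomain.compl_subset_closure_interior
    (hΩ : IsBoundedLipschitzDomain Ω) : Ωᶜ ⊆ closure (interior Ωᶜ) := by
  intro p hp
  by_cases hpi : p ∈ interior Ωᶜ
  · exact subset_closure hpi
  have hpf : p ∈ frontier Ω := by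
    rw [← frontier_compl]
    exact ⟨subset_closure hp, hpi⟩
  obtain ⟨e, L, γ, r, he, hγ, hr, h⟩ := hΩ.lipschitz_boundary p hpf
  have hp1 : inner ℝ e p ≤ γ (p - (inner ℝ e p) • e) :=
    not_lt.1 fun h' => hp ((h p (Metric.mem_ball_self hr)).2 h')
  let U : Set (E d) := Metric.ball p r ∩ {x | inner ℝ e x < γ (x - (inner ℝ e x) • e)}
  have hγc := hγ.continuous
  have hU : IsOpen U := Metric.isOpen_ball.inter (isOpen_lt (by fun_prop) (by fun_prop))
  have hUΩ : U ⊆ Ωᶜ := fun x hx hxΩ => lt_asymm ((h x hx.1).1 hxΩ) hx.2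
  have hee : inner ℝ e e = 1 := by rw [real_inner_self_eq_norm_sq, he, one_pow]
  refine Metric.mem_closure_iff.2 fun ε hε => ?_
  set t := min ε r / 2 with ht
  have hmin : 0 < min ε r := lt_min hε hr
  have ht0 : 0 < t := by positivity
  have hte : t < ε := by linarith [min_le_left ε r]
  have htr : t < r := by linarith [min_le_right ε r]
  refine ⟨p - t • e, interior_maximal hUΩ hU ⟨?_, ?_⟩, ?_⟩
  · rw [mem_ball_iff_norm, sub_sub_cancel_left, norm_neg, norm_smul, he, mul_one,
      Real.norm_of_nonneg ht0.le]
    exact htr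
  · have h1 : inner ℝ e (p - t • e) = inner ℝ e p - t := by
      rw [inner_sub_right, real_inner_smul_right, hee, mul_one]
    have h2 : p - t • e - (inner ℝ e (p - t • e)) • e = p - (inner ℝ e p) • e := by
      rw [h1, sub_smul]
      abel
    change inner ℝ e (p - t • e) < γ (p - t • e - (inner ℝ e (p - t • e)) • e)
    rw [h2, h1]
    linarith
  · rw [dist_eq_norm, sub_sub_cancel, norm_smul, he, mul_one, Real.norm_of_nonneg ht0.le]
    exact hte

theorem exists_ae_norm_le {X : Type*} [MeasurableSpace X] {μ : Measure X} {f : X → ℂ}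
    (hf : MemLp f ∞ μ) : ∃ C, ∀ᵐ x ∂μ, ‖f x‖ ≤ C := by
  refine ⟨(eLpNorm f ∞ μ).toReal, ?_⟩
  filter_upwards [ae_le_eLpNormEssSup (f := f) (μ := μ)] with x hx
  rw [← eLpNorm_exponent_top] at hx
  simpa using ENNReal.toReal_mono hf.2.ne hx

theorem _root_.MeasureTheory.MemLp.locallyIntegrable_top {f : E d → ℂ}
    (hf : MemLp f ∞ (volume : Measure (E d))) : LocallyIntegrable f (volume : Measure (E d)) :=
  hf.locallyIntegrable le_top

/-- A function with bounded weak gradient that vanishes off a set with sufficiently regular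
complement `V` is dominated by the distance to `V`. -/
theorem ae_norm_le_infDist {f : E d → ℂ} {g : Fin d → E d → ℂ} {V : Set (E d)}
    (hf : LocallyIntegrable f (volume : Measure (E d))) (hfg : HasWeakGradient univ f g)
    {C : Fin d → ℝ} (hg : ∀ j, ∀ᵐ x, ‖g j x‖ ≤ C j) (hV : ∀ x ∈ V, f x = 0)
    (hVc : V ⊆ closure (interior V)) (hVn : V.Nonempty) :
    ∀ᵐ x, ‖f x‖ ≤ (∑ j, C j) * Metric.infDist x V := by
  filter_upwards [ae_tendsto_mollify hf] with x hx
  have h1 : ∀ y ∈ interior V, ‖f x‖ ≤ (∑ j, C j) * dist x y := by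
    intro y hy
    obtain ⟨r, hr, hrV⟩ := Metric.isOpen_iff.1 isOpen_interior y hy
    refine le_of_tendsto hx.norm ?_
    filter_upwards [(tendsto_mollifier_rOut d).eventually (gt_mem_nhds hr)] with n hn
    -- Around an interior point of `V`, small mollification balls stay in `V`, so the mollified
    -- function vanishes exactly at y. The mean value inequality from y to x, followed by n → ∞,
    -- bounds f(x).
    have h2 : mollify (mollifier d n) f y = 0 := by
      rw [mollify_eq_of_ball, hV y (interior_subset hy)]
      intro z hz
      rw [hV y (interior_subset hy),
        hV z (interior_subset (hrV (Metric.ball_subset_ball (le_of_lt hn) hz)))]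
    have h3 := norm_sub_le_of_norm_partialDeriv_le
      ((contDiff_mollify (mollifier d n) hf).differentiable (by simp)) (C := C)
      (fun j z => by
        rw [partialDeriv_mollify _ hf hfg]
        exact norm_mollify_le _ (hg j) z) x y
    rwa [h2, sub_zero, ← dist_eq_norm] at h3
  have h2 : ∀ y ∈ V, ‖f x‖ ≤ (∑ j, C j) * dist x y := fun y hy =>
    closure_minimal (t := {y | ‖f x‖ ≤ (∑ j, C j) * dist x y}) h1
      (isClosed_le continuous_const (by fun_prop)) (hVc hy)
  have hC : 0 ≤ ∑ j, C j := Finset.sum_nonneg fun j _ => by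
    obtain ⟨z, hz⟩ := (hg j).exists
    exact (norm_nonneg _).trans hz
  -- Passing to the infimum over `V` divides by the constant, so a zero constant is treated apart.
  rcases hC.eq_or_lt with h0 | h0
  · obtain ⟨y, hy⟩ := hVn
    simpa [← h0] using h2 y hy
  · rw [mul_comm, ← div_le_iff₀ h0, Metric.le_infDist hVn]
    intro y hy
    rw [div_le_iff₀ h0, mul_comm]
    exact h2 y hy

end Boundary

/-! ### Cutoffs adapted to the distance from a set. -/

section Cutoff

/-- Smooth cutoff functions supported away from `V`, with gradient controlled by the inverse
distance to `V`. -/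
theorem exists_smooth_cutoff (V : Set (E d)) {ε : ℝ} (hε : 0 < ε) :
    ∃ χ : E d → ℂ, ContDiff ℝ ∞ χ ∧ (∀ x, ‖χ x‖ ≤ 1) ∧
      (∀ x, Metric.infDist x V < ε / 2 → χ x = 0) ∧
      (∀ x, 5 / 2 * ε < Metric.infDist x V → χ x = 1) ∧
      (∀ x j, 5 / 2 * ε < Metric.infDist x V → partialDeriv j χ x = 0) ∧
      ∀ x j, ‖partialDeriv j χ x‖ * Metric.infDist x V ≤ 5 / 2 := by
  -- A ramp in the distance, 0 up to ε and 1 from 2ε on, with Lipschitz constant 1/ε. Mollifying at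
  -- radius ε/2 moves the thresholds to ε/2 and 5ε/2; where the gradient is nonzero the distance is
  -- at most 5ε/2, which gives the final 5/2.
  let h : E d → ℂ := fun x => ((min 1 (max 0 (Metric.infDist x V / ε - 1)) : ℝ) : ℂ)
  have hdist : ∀ x y, |Metric.infDist x V - Metric.infDist y V| ≤ dist x y := fun x y => by
    simpa [Real.dist_eq] using (Metric.lipschitz_infDist_pt V).dist_le_mul x y
  have hLip : LipschitzWith (Real.toNNReal ε⁻¹) h := by
    refine LipschitzWith.of_dist_le_mul fun x y => ?_
    have h1 : dist (h x) (h y) = |min 1 (max 0 (Metric.infDist x V / ε - 1))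
        - min 1 (max 0 (Metric.infDist y V / ε - 1))| := by
      rw [Complex.dist_of_im_eq (by simp [h])]
      simp [h, Real.dist_eq]
    rw [h1, Real.coe_toNNReal _ (inv_nonneg.2 hε.le)]
    have h2 := abs_min_sub_min_le_max 1 (max 0 (Metric.infDist x V / ε - 1)) 1
      (max 0 (Metric.infDist y V / ε - 1))
    have h3 := abs_max_sub_max_le_max 0 (Metric.infDist x V / ε - 1) 0
      (Metric.infDist y V / ε - 1)
    rw [sub_self, abs_zero] at h2 h3
    refine (h2.trans_eq (max_eq_right (abs_nonneg _))).trans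
      ((h3.trans_eq (max_eq_right (abs_nonneg _))).trans ?_)
    have h4 : Metric.infDist x V / ε - 1 - (Metric.infDist y V / ε - 1)
        = ε⁻¹ * (Metric.infDist x V - Metric.infDist y V) := by
      field_simp
      ring
    rw [h4, abs_mul, abs_of_pos (inv_pos.2 hε)]
    exact mul_le_mul_of_nonneg_left (hdist x y) (inv_nonneg.2 hε.le)
  have hh1 : ∀ x, ‖h x‖ ≤ 1 := fun x => by
    rw [Complex.norm_real, Real.norm_of_nonneg (le_min zero_le_one (le_max_left _ _))]
    exact min_le_left _ _
  have hh0 : ∀ x, Metric.infDist x V ≤ ε → h x = 0 := fun x hx => by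
    have : Metric.infDist x V / ε - 1 ≤ 0 := by
      rw [sub_nonpos, div_le_one hε]
      exact hx
    simp [h, max_eq_left this]
  have hh2 : ∀ x, 2 * ε ≤ Metric.infDist x V → h x = 1 := fun x hx => by
    have : 1 ≤ Metric.infDist x V / ε - 1 := by
      rw [le_sub_iff_add_le, le_div_iff₀ hε]
      linarith
    simp [h, max_eq_right (zero_le_one.trans this), min_eq_left this]
  let ρ : ContDiffBump (0 : E d) := ⟨ε / 4, ε / 2, by positivity, by linarith⟩
  have hball : ∀ x, ∀ y ∈ Metric.ball x ρ.rOut,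
      |Metric.infDist y V - Metric.infDist x V| < ε / 2 := fun x y hy =>
    (hdist y x).trans_lt hy
  have hone : ∀ x, 5 / 2 * ε < Metric.infDist x V → mollify ρ h x = 1 := fun x hx => by
    rw [mollify_eq_of_ball, hh2 x (by linarith)]
    intro y hy
    have := (abs_lt.1 (hball x y hy)).1
    rw [hh2 x (by linarith), hh2 y (by linarith)]
  have hder : ∀ x j, 5 / 2 * ε < Metric.infDist x V → partialDeriv j (mollify ρ h) x = 0 := by
    intro x j hx
    have h1 : mollify ρ h =ᶠ[𝓝 x] fun _ => 1 := by
      filter_upwards [(isOpen_lt continuous_const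
        (Metric.continuous_infDist_pt V)).mem_nhds hx] with y hy
      exact hone y hy
    unfold partialDeriv
    rw [h1.fderiv_eq]
    simp
  refine ⟨mollify ρ h, contDiff_mollify ρ hLip.continuous.locallyIntegrable,
    norm_mollify_le ρ (Eventually.of_forall hh1), fun x hx => ?_, hone, hder, fun x j => ?_⟩
  · rw [mollify_eq_of_ball, hh0 x (by linarith)]
    intro y hy
    have := (abs_lt.1 (hball x y hy)).2
    rw [hh0 x (by linarith), hh0 y (by linarith)]
  · rcases lt_or_ge (5 / 2 * ε) (Metric.infDist x V) with hx | hx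
    · rw [hder x j hx, norm_zero, zero_mul]
      norm_num
    · have hLip' : LipschitzWith (Real.toNNReal ε⁻¹) (mollify ρ h) :=
        LipschitzWith.of_dist_le_mul fun y z => by
          rw [dist_eq_norm, dist_eq_norm]
          exact norm_mollify_sub_le ρ hLip y z
      have h1 : ‖partialDeriv j (mollify ρ h) x‖ ≤ ε⁻¹ := by
        have h2 := norm_fderiv_le_of_lipschitz ℝ (x₀ := x) hLip'
        rw [Real.coe_toNNReal _ (inv_nonneg.2 hε.le)] at h2
        refine ((fderiv ℝ (mollify ρ h) x).le_opNorm _).trans ?_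
        simpa using h2
      calc _ ≤ ε⁻¹ * (5 / 2 * ε) :=
            mul_le_mul h1 hx Metric.infDist_nonneg (inv_nonneg.2 hε.le)
        _ = 5 / 2 := by field_simp

end Cutoff

end AcousticVIE

namespace AcousticVIE

variable {d : ℕ} {Ω : Set (E d)} {α : E d → ℂ}

/-! ### The product rule on all of H¹. -/

section GlobalProductRule

theorem tendsto_integral_mul_of_bounded {X : Type*} [MeasurableSpace X] {μ : Measure X}
    {f b : X → ℂ} {B : ℕ → X → ℂ} {C : ℝ} (hf : Integrable f μ)
    (hB : ∀ n, AEStronglyMeasurable (B n) μ) (hC : ∀ n, ∀ᵐ x ∂μ, ‖B n x‖ ≤ C)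
    (hlim : ∀ᵐ x ∂μ, Tendsto (fun n => B n x) atTop (𝓝 (b x))) :
    Tendsto (fun n => ∫ x, f x * B n x ∂μ) atTop (𝓝 (∫ x, f x * b x ∂μ)) := by
  refine tendsto_integral_of_dominated_convergence (fun x => ‖f x‖ * C)
    (fun n => hf.1.mul (hB n)) (hf.norm.mul_const C) (fun n => ?_) ?_
  · filter_upwards [hC n] with x hx
    rw [norm_mul]
    exact mul_le_mul_of_nonneg_left hx (norm_nonneg _)
  · filter_upwards [hlim] with x hx
    exact hx.const_mul _

/-- The product rule for a bounded function with bounded weak gradient and a function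
in `H¹(Ω)`, tested inside `Ω`. -/
theorem product_rule_interior (hΩ : MeasurableSet Ω) (hΩb : Bornology.IsBounded Ω)
    (hα : MemLp α ∞ ((volume : Measure (E d)).restrict Ω)) {g : Fin d → E d → ℂ}
    (hg : ∀ j, MemLp (g j) ∞ (volume : Measure (E d)))
    (hαg : HasWeakGradient univ (Ω.indicator α) g) (u : H1 Ω) {φ : E d → ℂ} (hφ : IsTest Ω φ)
    (j : Fin d) :
    ∫ x in Ω, α x * toL2 u x * partialDeriv j φ x
      = -∫ x in Ω, (α x * grad u j x + g j x * toL2 u x) * φ x := by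
  have : IsFiniteMeasure ((volume : Measure (E d)).restrict Ω) :=
    ⟨by simpa using hΩb.measure_lt_top⟩
  have hi : ∀ f : L2 Ω, Integrable f ((volume : Measure (E d)).restrict Ω) := fun f =>
    (Lp.memLp f).integrable (by norm_num)
  have hα0 : MemLp (Ω.indicator α) ∞ (volume : Measure (E d)) :=
    (memLp_indicator_iff_restrict hΩ).2 hα
  have hαl := hα0.locallyIntegrable_top
  obtain ⟨Cα, hCα⟩ := exists_ae_norm_le hα0
  obtain ⟨Cg, hCg⟩ := exists_ae_norm_le (hg j)
  obtain ⟨Cφ, hCφ⟩ := hφ.exists_bound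
  obtain ⟨Cφ', hCφ'⟩ := (hφ.partialDeriv j).exists_bound
  have hCα0 : 0 ≤ Cα := by
    obtain ⟨z, hz⟩ := hCα.exists
    exact (norm_nonneg _).trans hz
  have hCg0 : 0 ≤ Cg := by
    obtain ⟨z, hz⟩ := hCg.exists
    exact (norm_nonneg _).trans hz
  let a : ℕ → E d → ℂ := fun n => mollify (mollifier d n) (Ω.indicator α)
  let b : ℕ → E d → ℂ := fun n => mollify (mollifier d n) (g j)
  have ha : ∀ n, ContDiff ℝ ∞ (a n) := fun n => contDiff_mollify _ hαl
  have hb : ∀ n, Continuous (b n) := fun n =>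
    (contDiff_mollify _ (hg j).locallyIntegrable_top).continuous
  have hab : ∀ n, partialDeriv j (a n) = b n := fun n => partialDeriv_mollify _ hαl hαg j
  have ha1 : ∀ n x, ‖a n x‖ ≤ Cα := fun n => norm_mollify_le _ hCα
  have hb1 : ∀ n x, ‖b n x‖ ≤ Cg := fun n => norm_mollify_le _ hCg
  have ha2 : ∀ᵐ x ∂((volume : Measure (E d)).restrict Ω),
      Tendsto (fun n => a n x) atTop (𝓝 (α x)) := by
    filter_upwards [ae_restrict_of_ae (ae_tendsto_mollify hαl), ae_restrict_mem hΩ] with x h1 h2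
    rwa [indicator_of_mem h2] at h1
  have hb2 : ∀ᵐ x ∂((volume : Measure (E d)).restrict Ω),
      Tendsto (fun n => b n x) atTop (𝓝 (g j x)) :=
    ae_restrict_of_ae (ae_tendsto_mollify (hg j).locallyIntegrable_top)
  -- The mollified α times φ is an admissible test function for the weak gradient of u. Uniform
  -- bounds and almost everywhere convergence allow the limit in n.
  have key : ∀ n, ∫ x in Ω, toL2 u x * (a n x * partialDeriv j φ x + b n x * φ x)
      = -∫ x in Ω, grad u j x * (a n x * φ x) := by
    intro n
    have h1 := hasWeakGradient_H1 u _ (hφ.mul_left (ha n)) j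
    simp_rw [partialDeriv_mul ((ha n).differentiable (by simp)) hφ.differentiable, hab] at h1
    exact h1
  have l1 : Tendsto (fun n => ∫ x in Ω, toL2 u x * (a n x * partialDeriv j φ x + b n x * φ x))
      atTop (𝓝 (∫ x in Ω, toL2 u x * (α x * partialDeriv j φ x + g j x * φ x))) := by
    refine tendsto_integral_mul_of_bounded (C := Cα * Cφ' + Cg * Cφ) (hi _) (fun n => ?_)
      (fun n => Eventually.of_forall fun x => ?_) ?_
    · exact (((ha n).continuous.mul (hφ.partialDeriv j).continuous).add
        ((hb n).mul hφ.continuous)).aestronglyMeasurable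
    · refine (norm_add_le _ _).trans ?_
      rw [norm_mul, norm_mul]
      exact add_le_add (mul_le_mul (ha1 n x) (hCφ' x) (norm_nonneg _) hCα0)
        (mul_le_mul (hb1 n x) (hCφ x) (norm_nonneg _) hCg0)
    · filter_upwards [ha2, hb2] with x h1 h2
      exact (h1.mul_const _).add (h2.mul_const _)
  have l2 : Tendsto (fun n => ∫ x in Ω, grad u j x * (a n x * φ x))
      atTop (𝓝 (∫ x in Ω, grad u j x * (α x * φ x))) := by
    refine tendsto_integral_mul_of_bounded (C := Cα * Cφ) (hi _) (fun n => ?_)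
      (fun n => Eventually.of_forall fun x => ?_) ?_
    · exact ((ha n).continuous.mul hφ.continuous).aestronglyMeasurable
    · rw [norm_mul]
      exact mul_le_mul (ha1 n x) (hCφ x) (norm_nonneg _) hCα0
    · filter_upwards [ha2] with x h1
      exact h1.mul_const _
  simp_rw [key] at l1
  have h := tendsto_nhds_unique l1 l2.neg
  have i1 : ∀ (f : L2 Ω) {m : E d → ℂ}, MemLp m ∞ ((volume : Measure (E d)).restrict Ω) →
      ∀ {ψ : E d → ℂ}, IsTest Ω ψ →
      Integrable (fun x => m x * f x * ψ x) ((volume : Measure (E d)).restrict Ω) := by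
    intro f m hm ψ hψ
    have h1 := (Lp.memLp (mulL2 hm f)).integrable_mul (q := 2) (hψ.memLp Ω)
    refine h1.congr ?_
    filter_upwards [coeFn_mulL2 hm f] with x hx
    simp only [Pi.mul_apply, hx]
  have i2 := i1 (toL2 u) hα (hφ.partialDeriv j)
  have i3 := i1 (toL2 u) ((hg j).restrict Ω) hφ
  have i4 := i1 (grad u j) hα hφ
  have e1 : ∀ x, toL2 u x * (α x * partialDeriv j φ x + g j x * φ x)
      = α x * toL2 u x * partialDeriv j φ x + g j x * toL2 u x * φ x := fun x => by ring
  have e2 : ∀ x, grad u j x * (α x * φ x) = α x * grad u j x * φ x := fun x => by ring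
  simp_rw [e1, e2] at h
  rw [integral_add i2 i3] at h
  simp_rw [add_mul]
  rw [integral_add i4 i3]
  linear_combination h

/-- If `α`, extended by zero, has a bounded weak gradient on the whole space, then the product
rule holds on the whole space for every `u ∈ H¹(Ω)`. -/
theorem hasProductRule_of_hasWeakGradient_univ (hd : 1 ≤ d) (hΩ : IsBoundedLipschitzDomain Ω)
    (hα : MemLp α ∞ ((volume : Measure (E d)).restrict Ω)) {g : Fin d → E d → ℂ}
    (hg : ∀ j, MemLp (g j) ∞ (volume : Measure (E d)))
    (hαg : HasWeakGradient univ (Ω.indicator α) g) (u : H1 Ω) :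
    HasProductRule hα (fun j => (hg j).restrict Ω) u := by
  rw [hasProductRule_iff]
  intro ψ hψ j
  have hΩm := hΩ.isOpen.measurableSet
  have hΩb := hΩ.isBounded
  have : IsFiniteMeasure ((volume : Measure (E d)).restrict Ω) :=
    ⟨by simpa using hΩb.measure_lt_top⟩
  have hi : ∀ f : L2 Ω, Integrable f ((volume : Measure (E d)).restrict Ω) := fun f =>
    (Lp.memLp f).integrable (by norm_num)
  have hα0 : MemLp (Ω.indicator α) ∞ (volume : Measure (E d)) :=
    (memLp_indicator_iff_restrict hΩm).2 hα
  -- Since d ≥ 1, the bounded set Ω is not the whole space. Otherwise `infDist` to the empty set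
  -- would be 0 and carry no information.
  have hVn : (Ωᶜ).Nonempty := by
    have : Nonempty (Fin d) := ⟨⟨0, hd⟩⟩
    rw [nonempty_compl]
    rintro rfl
    exact NormedSpace.unbounded_univ ℝ (E d) hΩb
  have hVcl : IsClosed Ωᶜ := hΩ.isOpen.isClosed_compl
  have hδ : ∀ x ∈ Ω, 0 < Metric.infDist x Ωᶜ := fun x hx =>
    (hVcl.notMem_iff_infDist_pos hVn).1 (fun h => h hx)
  choose Cg hCg using fun j => exists_ae_norm_le (hg j)
  set L := ∑ j, Cg j
  have hdom : ∀ᵐ x ∂((volume : Measure (E d)).restrict Ω),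
      ‖α x‖ ≤ L * Metric.infDist x Ωᶜ := by
    filter_upwards [ae_restrict_of_ae (ae_norm_le_infDist hα0.locallyIntegrable_top hαg hCg
      (fun x hx => indicator_of_notMem hx α) hΩ.compl_subset_closure_interior hVn),
      ae_restrict_mem hΩm] with x h1 h2
    rwa [indicator_of_mem h2] at h1
  obtain ⟨Cα, hCα⟩ := exists_ae_norm_le hα
  obtain ⟨Cψ, hCψ⟩ := hψ.exists_bound
  obtain ⟨Cψ', hCψ'⟩ := (hψ.partialDeriv j).exists_bound
  have hε : ∀ n : ℕ, (0 : ℝ) < 1 / (n + 1) := fun n => by positivity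
  choose χ hχs hχ1 hχ0 hχe hχd hχb using fun n => exists_smooth_cutoff Ωᶜ (hε n)
  have hφ : ∀ n, IsTest Ω (fun x => ψ x * χ n x) := fun n => by
    have h1 := hψ.mul_right (hχs n)
    refine ⟨h1.contDiff, h1.hasCompactSupport, ?_⟩
    have h2 : tsupport (fun x => ψ x * χ n x)
        ⊆ {x | 1 / ((n : ℝ) + 1) / 2 ≤ Metric.infDist x Ωᶜ} := by
      refine closure_minimal (fun x hx => ?_)
        (isClosed_le continuous_const (Metric.continuous_infDist_pt _))
      by_contra hlt
      exact hx (by simp only [hχ0 n x (not_le.1 hlt), mul_zero])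
    refine h2.trans fun x hx => ?_
    by_contra hxΩ
    have h3 : Metric.infDist x Ωᶜ = 0 := Metric.infDist_zero_of_mem hxΩ
    have h4 : 1 / ((n : ℝ) + 1) / 2 ≤ Metric.infDist x Ωᶜ := hx
    rw [h3] at h4
    linarith [hε n]
  have hev : ∀ x ∈ Ω, ∀ᶠ n : ℕ in atTop, 5 / 2 * (1 / ((n : ℝ) + 1)) < Metric.infDist x Ωᶜ := by
    intro x hx
    have h1 := (tendsto_one_div_add_atTop_nhds_zero_nat (𝕜 := ℝ)).const_mul (5 / 2)
    rw [mul_zero] at h1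
    exact h1.eventually (gt_mem_nhds (hδ x hx))
  -- The interior rule tested with ψχ_n; the term containing ∂_jχ_n has to disappear in the limit.
  have key : ∀ n, ∫ x in Ω, toL2 u x
        * (α x * (ψ x * partialDeriv j (χ n) x + partialDeriv j ψ x * χ n x))
      = -∫ x in Ω, (α x * grad u j x + g j x * toL2 u x) * (ψ x * χ n x) := by
    intro n
    rw [← product_rule_interior hΩm hΩb hα hg hαg u (hφ n) j]
    simp_rw [partialDeriv_mul hψ.differentiable ((hχs n).differentiable (by simp))]
    congr 1
    funext x
    ring
  have l1 : Tendsto (fun n => ∫ x in Ω, toL2 u x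
        * (α x * (ψ x * partialDeriv j (χ n) x + partialDeriv j ψ x * χ n x)))
      atTop (𝓝 (∫ x in Ω, toL2 u x * (α x * partialDeriv j ψ x))) := by
    refine tendsto_integral_mul_of_bounded (C := Cψ * (L * (5 / 2)) + Cα * Cψ') (hi _)
      (fun n => ?_) (fun n => ?_) ?_
    · exact hα.1.mul ((hψ.continuous.mul (contDiff_partialDeriv (hχs n) j).continuous).add
        ((hψ.partialDeriv j).continuous.mul (hχs n).continuous)).aestronglyMeasurable
    · filter_upwards [hCα, hdom, ae_restrict_mem hΩm] with x h1 h2 h3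
      -- The decisive bound: ∂_jχ_n grows like the inverse distance to Ωᶜ, and α vanishes linearly
      -- there. Thus α ∂_jχ_n is bounded uniformly in n, and at each point of Ω it is eventually 0.
      have h4 : ‖α x‖ * ‖partialDeriv j (χ n) x‖ ≤ L * (5 / 2) := by
        have hL : 0 ≤ L := nonneg_of_mul_nonneg_left ((norm_nonneg _).trans h2) (hδ x h3)
        calc _ ≤ L * Metric.infDist x Ωᶜ * ‖partialDeriv j (χ n) x‖ :=
              mul_le_mul_of_nonneg_right h2 (norm_nonneg _)
          _ = L * (‖partialDeriv j (χ n) x‖ * Metric.infDist x Ωᶜ) := by ring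
          _ ≤ _ := mul_le_mul_of_nonneg_left (hχb n x j) hL
      have hα1 : 0 ≤ Cα := (norm_nonneg _).trans h1
      have hψ1 : 0 ≤ Cψ' := (norm_nonneg _).trans (hCψ' x)
      have hψ0 : 0 ≤ Cψ := (norm_nonneg _).trans (hCψ x)
      rw [mul_add]
      refine (norm_add_le _ _).trans (add_le_add ?_ ?_)
      · rw [norm_mul, norm_mul, mul_left_comm]
        exact mul_le_mul (hCψ x) h4 (by positivity) hψ0
      · rw [norm_mul, norm_mul]
        refine mul_le_mul h1 ?_ (by positivity) hα1
        calc _ ≤ Cψ' * 1 := mul_le_mul (hCψ' x) (hχ1 n x) (norm_nonneg _) hψ1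
          _ = Cψ' := mul_one _
    · filter_upwards [ae_restrict_mem hΩm] with x hx
      refine tendsto_const_nhds.congr' ?_
      filter_upwards [hev x hx] with n hn
      rw [hχd n x j hn, hχe n x hn]
      ring
  have hf : Integrable (fun x => α x * grad u j x + g j x * toL2 u x)
      ((volume : Measure (E d)).restrict Ω) :=
    ((hi (mulL2 hα (grad u j))).congr (coeFn_mulL2 hα _)).add
      ((hi (mulL2 ((hg j).restrict Ω) (toL2 u))).congr (coeFn_mulL2 _ _))
  have l2 : Tendsto (fun n => ∫ x in Ω, (α x * grad u j x + g j x * toL2 u x) * (ψ x * χ n x))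
      atTop (𝓝 (∫ x in Ω, (α x * grad u j x + g j x * toL2 u x) * ψ x)) := by
    refine tendsto_integral_mul_of_bounded (C := Cψ) hf (fun n => ?_)
      (fun n => Eventually.of_forall fun x => ?_) ?_
    · exact (hψ.continuous.mul (hχs n).continuous).aestronglyMeasurable
    · rw [norm_mul]
      calc _ ≤ Cψ * 1 := mul_le_mul (hCψ x) (hχ1 n x) (norm_nonneg _)
            ((norm_nonneg _).trans (hCψ x))
        _ = Cψ := mul_one _
    · filter_upwards [ae_restrict_mem hΩm] with x hx
      refine tendsto_const_nhds.congr' ?_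
      filter_upwards [hev x hx] with n hn
      rw [hχe n x hn, mul_one]
  simp_rw [key] at l1
  rw [← tendsto_nhds_unique l1 l2.neg]
  congr 1
  funext x
  ring

end GlobalProductRule

end AcousticVIE


end

theorem propositionp (d : ℕ) (hd : 1 ≤ d) (Ω : Set (E d)) (hΩ : IsBoundedLipschitzDomain Ω)
    (k : ℂ) (G : E d → ℂ) (hG : IsOutgoingFundamentalSolution k G)
    (α β : E d → ℂ)
    (hα : MemLp α ∞ ((volume : Measure (E d)).restrict Ω))
    (hβ : MemLp β ∞ ((volume : Measure (E d)).restrict Ω)) :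
    -- `A` is a bounded operator in `H¹(Ω)`
    (∃ A : H1 Ω →L[ℂ] H1 Ω, ∀ u : H1 Ω, VolumeOperatorEq Ω G α β u (toL2 (A u))) ∧
    -- if `α`, extended by zero, has a bounded gradient on `ℝ^d`, then `A` is bounded in `L²(Ω)`
    ((∃ g : Fin d → E d → ℂ, (∀ j, MemLp (g j) ∞ (volume : Measure (E d))) ∧
        HasWeakGradient univ (Ω.indicator α) g) →
      ∃ A : L2 Ω →L[ℂ] L2 Ω, ∀ u : H1 Ω, VolumeOperatorEq Ω G α β u (A (toL2 u))) ∧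
    -- if `α` has a bounded gradient on `Ω` only, the same holds for `A` restricted to `H¹₀(Ω)`
    ((∃ g : Fin d → E d → ℂ,
        (∀ j, MemLp (g j) ∞ ((volume : Measure (E d)).restrict Ω)) ∧ HasWeakGradient Ω α g) →
      ∃ A : L2 Ω →L[ℂ] L2 Ω, ∀ u ∈ H10 Ω, VolumeOperatorEq Ω G α β u (A (toL2 u))) := by
  have hΩm := hΩ.isOpen.measurableSet
  refine ⟨exists_H1_operator hΩm hΩ.isBounded hG hα hβ, ?_, ?_⟩
  · rintro ⟨g, hg, hαg⟩
    obtain ⟨A, hA⟩ := exists_L2_operator hΩm hΩ.isBounded hG hα hβ fun j => (hg j).restrict Ω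
    exact ⟨A, fun u => hA u (hasProductRule_of_hasWeakGradient_univ hd hΩ hα hg hαg u)⟩
  · rintro ⟨g, hg, hαg⟩
    obtain ⟨A, hA⟩ := exists_L2_operator hΩm hΩ.isBounded hG hα hβ hg
    exact ⟨A, fun u hu => hA u (hasProductRule_of_mem_H10 hΩ.isOpen hα hg hαg hu)⟩
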